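/- Let $w:\mathbb{Z}\to[0,\infty)$ satisfy $w(0)=0$, $w(-k)=w(k)$ and $\sum_k w(k)<\infty$, and let $\Gamma$ be the $\mathbb{Z}$-periodic weighted graph with vertex set $\mathbb{Z}$ in which $n$ and $n+k$ are joined by an edge of weight $w(k)$. Its adjacency operator is the bounded operator $(\mathcal{A}_\Gamma\psi)(n)=\sum_{k\in\mathbb{Z}}w(k)\psi(n+k)$ on $\ell^2(\mathbb{Z})$. Let $\mathcal{A}_{\mathbb{Z}}$ be this operator for $w(\pm1)=1$ and $w(k)=0$ otherwise. Write $(x\psi)(n)=n\psi(n)$, and let $\delta_n$ be the point mass at $n$. A bounded self-adjoint operator $A$ on $\ell^2(\mathbb{Z})$ has *purely absolutely continuous spectrum* if for every $\psi\in\ell^2(\mathbb{Z})$ its spectral measure at $\psi$ is absolutely continuous with respect to Lebesgue measure. A state $\psi$ *spreads out at ballistic speed* under $A$ if $\|x\mathrm{e}^{-\mathrm{i}tA}\psi\|<\infty$ for all $t\in\mathbb{R}$ and $\lim_{t\to\infty}\|x\mathrm{e}^{-\mathrm{i}tA}\psi\|^2/t^2$ exists, is finite and is positive. For $\alpha>0$,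 $A$ *disperses with rate $\alpha$* if there is a constant $C$ such that $\|\mathrm{e}^{-\mathrm{i}tA}\psi\|_\infty\le C\,t^{-\alpha}\|\psi\|_1$ for all $t>0$ and all $\psi\in\ell^1(\mathbb{Z})$. 1. Let $w(k)=k^{-2}$ for all $k\ne0$. Then $\mathcal{A}_\Gamma$ is self-adjoint with purely absolutely continuous spectrum, and every $\psi\neq0$ in $\ell^2(\mathbb{Z})$ with $\|x\psi\|<\infty$ spreads out at ballistic speed. Moreover $\mathcal{A}_\Gamma$ disperses faster than $\mathcal{A}_{\mathbb{Z}}$: there is a constant $C$ with $\|\mathrm{e}^{-\mathrm{i}t\mathcal{A}_\Gamma}\psi\|_\infty\le C\,t^{-1/2}\|\psi\|_1$ for all $t>0$ and $\psi\in\ell^1(\mathbb{Z})$, whereas $\mathcal{A}_{\mathbb{Z}}$ does not disperse with rate $1/2$. 2. Let $w(k)=k^{-2}$ for odd $k$ and $w(k)=0$ for even $k$. Then $\mathcal{A}_\Gamma$ is self-adjoint with purely absolutely continuous spectrum, and every $\psi\neq0$ in $\ell^2(\mathbb{Z})$ with $\|x\psi\|<\infty$ spreads out at ballistic speed. However, $\mathcal{A}_\Gamma$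 violates dispersion: it does not disperse with any rate $\alpha>0$, and $\|\mathrm{e}^{-\mathrm{i}t\mathcal{A}_\Gamma}\delta_n\|_\infty>\frac1\pi$ for all $n\in\mathbb{Z}$ and $t\in\mathbb{R}$. In fact $\delta_n$ splits into two non-decaying tents that travel to the right and to the left at linear speed. Precisely, put $\varphi_t=\mathrm{e}^{-\mathrm{i}t\mathcal{A}_\Gamma}\delta_n$ and $s=\pi t/2$. Then: - $\varphi_0=\delta_n$; - $|\varphi_t(n\pm\lfloor s\rfloor)|>\frac1\pi$ for all $t\ge0$; - $|\varphi_t(n\pm k)|=\frac12$ at time $t=2k/\pi$, for every integer $k\ge1$; - $|\varphi_t(n+m)|<\frac12$ at time $t=2k/\pi$, for all integers $k\ge2$ and $m\ne\pm k$; - $|\varphi_t(n+m)|\le\dfrac{2}{\pi}\cdot\dfrac{s}{|s^2-m^2|}$ for all $t\ge0$ and all $m\in\mathbb{Z}$ with $|m|\neq s$. In particular $|\varphi_t(n+m)|\le\frac2\pi\,\big||m|-s\big|^{-1}$, so the wave decays polynomially away from the peaks, uniformly in time. 3. Let $w(k)=k^{-2}$ for odd $k$, $w(k)=2k^{-2}$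 for $k\in2\mathbb{Z}\setminus4\mathbb{Z}$, and $w(k)=0$ for $k\in4\mathbb{Z}$. Then $\mathcal{A}_\Gamma$ has a flat band all of whose eigenvectors have infinite support: there is $\lambda\in\mathbb{R}$ such that $\ker(\mathcal{A}_\Gamma-\lambda)$ is infinite-dimensional and every nonzero element of it has infinite support. Moreover $\mathcal{A}_\Gamma$ violates dispersion: it does not disperse with any rate $\alpha>0$, and in fact $|(\mathrm{e}^{-\mathrm{i}t\mathcal{A}_\Gamma}\delta_0)(0)|\ge\frac3{10}$ for all $t\in\mathbb{R}$. -/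

import Mathlib

open Filter Topology MeasureTheory

noncomputable section

/-- The Hilbert space `ℓ²(ℤ)` of complex square summable functions on `ℤ`. -/
abbrev EllTwo : Type := lp (fun _ : ℤ => ℂ) 2

/-- A `ℤ`-periodic weighted graph with vertex set `ℤ` and one vertex per period: the vertices `n`
and `n + k` are joined by an edge of weight `w k`, where weight `0` means that there is no edge. -/
structure PeriodicGraph where
  w : ℤ → ℝ
  w_nonneg : ∀ k, 0 ≤ w k
  w_zero : w 0 = 0
  w_neg : ∀ k, w (-k) = w k
  w_summable : Summable w

namespace EllTwo

/-- The translate `n ↦ ψ (n + k)`, used only to show that adjacency operators are bounded. -/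
def translate (k : ℤ) (ψ : EllTwo) : EllTwo :=
  ⟨fun n => ψ (n + k), by
    have h := (memℓp_gen_iff (p := 2) (by norm_num)).1 (lp.memℓp ψ)
    exact memℓp_gen ((Equiv.addRight k).summable_iff.2 h)⟩

theorem translate_apply (k : ℤ) (ψ : EllTwo) (n : ℤ) : translate k ψ n = ψ (n + k) := rfl

theorem norm_translate (k : ℤ) (ψ : EllTwo) : ‖translate k ψ‖ = ‖ψ‖ := by
  rw [lp.norm_eq_tsum_rpow (by norm_num), lp.norm_eq_tsum_rpow (by norm_num)]
  congr 1
  exact (Equiv.addRight k).tsum_eq (fun n => ‖ψ n‖ ^ (2 : ENNReal).toReal)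

end EllTwo

namespace PeriodicGraph

theorem summable_norm_smul_translate (Γ : PeriodicGraph) (ψ : EllTwo) :
    Summable fun k : ℤ => ‖(Γ.w k : ℂ) • EllTwo.translate k ψ‖ := by
  have h : (fun k : ℤ => ‖(Γ.w k : ℂ) • EllTwo.translate k ψ‖) = fun k => Γ.w k * ‖ψ‖ := by
    funext k
    rw [norm_smul, EllTwo.norm_translate, Complex.norm_real, Real.norm_of_nonneg (Γ.w_nonneg k)]
  rw [h]
  exact Γ.w_summable.mul_right _

theorem norm_tsum_smul_translate_le (Γ : PeriodicGraph) (ψ : EllTwo) :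
    ‖∑' k : ℤ, (Γ.w k : ℂ) • EllTwo.translate k ψ‖ ≤ (∑' k, Γ.w k) * ‖ψ‖ := by
  refine (norm_tsum_le_tsum_norm (Γ.summable_norm_smul_translate ψ)).trans (le_of_eq ?_)
  rw [← tsum_mul_right]
  refine tsum_congr fun k => ?_
  rw [norm_smul, EllTwo.norm_translate, Complex.norm_real, Real.norm_of_nonneg (Γ.w_nonneg k)]

theorem hasSum_adjacency (Γ : PeriodicGraph) (ψ : EllTwo) (n : ℤ) :
    HasSum (fun k : ℤ => (Γ.w k : ℂ) * ψ (n + k))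
      ((∑' k : ℤ, (Γ.w k : ℂ) • EllTwo.translate k ψ : EllTwo) n) := by
  have h := (Γ.summable_norm_smul_translate ψ).of_norm.hasSum
  exact h.mapL (lp.evalCLM ℂ (fun _ : ℤ => ℂ) (p := 2) n)

theorem tsum_adjacency (Γ : PeriodicGraph) (ψ : EllTwo) :
    (fun n : ℤ => ∑' k : ℤ, (Γ.w k : ℂ) * ψ (n + k)) =
      ((∑' k : ℤ, (Γ.w k : ℂ) • EllTwo.translate k ψ : EllTwo) : ℤ → ℂ) :=
  funext fun n => (Γ.hasSum_adjacency ψ n).tsum_eq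

/-- The adjacency operator `(𝒜 ψ)(n) = ∑ₖ w(k) ψ(n + k)`, a bounded operator on `ℓ²(ℤ)`. -/
def adjacency (Γ : PeriodicGraph) : EllTwo →L[ℂ] EllTwo :=
  LinearMap.mkContinuous
    { toFun := fun ψ => ⟨fun n : ℤ => ∑' k : ℤ, (Γ.w k : ℂ) * ψ (n + k), by
        rw [Γ.tsum_adjacency ψ]; exact lp.memℓp _⟩
      map_add' := fun ψ φ => by
        ext n
        change ∑' k : ℤ, (Γ.w k : ℂ) * (ψ (n + k) + φ (n + k)) =
          ∑' k : ℤ, (Γ.w k : ℂ) * ψ (n + k) + ∑' k : ℤ, (Γ.w k : ℂ) * φ (n + k)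
        rw [← (Γ.hasSum_adjacency ψ n).summable.tsum_add (Γ.hasSum_adjacency φ n).summable]
        simp only [mul_add]
      map_smul' := fun c ψ => by
        ext n
        change ∑' k : ℤ, (Γ.w k : ℂ) * (c * ψ (n + k)) = c * ∑' k : ℤ, (Γ.w k : ℂ) * ψ (n + k)
        rw [← tsum_mul_left]
        exact tsum_congr fun k => by ring }
    (∑' k, Γ.w k)
    (fun ψ => by
      have h := Γ.norm_tsum_smul_translate_le ψ
      refine le_trans (le_of_eq ?_) h
      exact congrArg norm (Subtype.ext (Γ.tsum_adjacency ψ) :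
        (⟨fun n : ℤ => ∑' k : ℤ, (Γ.w k : ℂ) * ψ (n + k), by
          rw [Γ.tsum_adjacency ψ]; exact lp.memℓp _⟩ : EllTwo) = _))

theorem adjacency_apply (Γ : PeriodicGraph) (ψ : EllTwo) (n : ℤ) :
    Γ.adjacency ψ n = ∑' k : ℤ, (Γ.w k : ℂ) * ψ (n + k) := rfl

end PeriodicGraph

theorem summable_int_inv_sq : Summable fun k : ℤ => 1 / (k : ℝ) ^ 2 :=
  Real.summable_one_div_int_pow.2 (by norm_num)

/-- The lattice `ℤ` with its nearest neighbour edges of weight `1`. -/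
def latticeGraph : PeriodicGraph where
  w k := if k = 1 ∨ k = -1 then 1 else 0
  w_nonneg k := by split_ifs <;> norm_num
  w_zero := by norm_num
  w_neg k := by
    have h : (-k = 1 ∨ -k = -1) ↔ (k = 1 ∨ k = -1) := by omega
    simp only [h]
  w_summable := by
    refine summable_of_ne_finset_zero (s := {1, -1}) fun k hk => ?_
    simp only [Finset.mem_insert, Finset.mem_singleton] at hk
    exact if_neg hk

/-- All edges: `w(k) = k⁻²` for `k ≠ 0`. -/
def fullGraph : PeriodicGraph where
  w k := if k = 0 then 0 else 1 / (k : ℝ) ^ 2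
  w_nonneg k := by split_ifs <;> positivity
  w_zero := by simp
  w_neg k := by simp
  w_summable := by
    refine Summable.of_nonneg_of_le (fun k => ?_) (fun k => ?_) summable_int_inv_sq
    · split_ifs <;> positivity
    · split_ifs
      · positivity
      · exact le_rfl

/-- Odd edges: `w(k) = k⁻²` for odd `k`, and `w(k) = 0` for even `k`. -/
def oddGraph : PeriodicGraph where
  w k := if k % 2 = 1 then 1 / (k : ℝ) ^ 2 else 0
  w_nonneg k := by split_ifs <;> positivity
  w_zero := by simp
  w_neg k := by
    have h : -k % 2 = 1 ↔ k % 2 = 1 := by omega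
    simp only [h, Int.cast_neg, neg_sq]
  w_summable := by
    refine Summable.of_nonneg_of_le (fun k => ?_) (fun k => ?_) summable_int_inv_sq
    · split_ifs <;> positivity
    · split_ifs
      · exact le_rfl
      · positivity

/-- The pattern modulo `4`: `w(k) = k⁻²` for odd `k`, `w(k) = 2 k⁻²` for `k ≡ 2` modulo `4`, and
`w(k) = 0` for `k` divisible by `4`. -/
def modFourGraph : PeriodicGraph where
  w k := if k % 2 = 1 then 1 / (k : ℝ) ^ 2 else if k % 4 = 2 then 2 / (k : ℝ) ^ 2 else 0
  w_nonneg k := by split_ifs <;> positivity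
  w_zero := by simp
  w_neg k := by
    have h : -k % 2 = 1 ↔ k % 2 = 1 := by omega
    have h4 : -k % 4 = 2 ↔ k % 4 = 2 := by omega
    simp only [h, h4, Int.cast_neg, neg_sq]
  w_summable := by
    refine Summable.of_nonneg_of_le (fun k => ?_) (fun k => ?_) (summable_int_inv_sq.mul_left 2)
    · split_ifs <;> positivity
    · have h : 0 ≤ 1 / (k : ℝ) ^ 2 := by positivity
      have h2 : 2 / (k : ℝ) ^ 2 = 2 * (1 / (k : ℝ) ^ 2) := by ring
      split_ifs <;> linarith

/-- The unitary group `e^{-itA}`, through the exponential series of bounded operators. -/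
def evolution (A : EllTwo →L[ℂ] EllTwo) (t : ℝ) : EllTwo →L[ℂ] EllTwo :=
  NormedSpace.exp ((-(Complex.I * (t : ℂ))) • A)

/-- The point mass at `n`. -/
def pointMass (n : ℤ) : EllTwo := lp.single 2 n (1 : ℂ)

/-- The supremum norm of an element of `ℓ²(ℤ)`. -/
def supNorm (ψ : EllTwo) : ℝ := ⨆ n : ℤ, ‖ψ n‖

theorem bddAbove_norm_range (ψ : EllTwo) : BddAbove (Set.range fun n : ℤ => ‖ψ n‖) :=
  ⟨‖ψ‖, by rintro _ ⟨n, rfl⟩; exact lp.norm_apply_le_norm (by norm_num) ψ n⟩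

/-- `μ` is the spectral measure of the self-adjoint operator `A` at the vector `ψ`, that is,
`⟨ψ, g(A) ψ⟩ = ∫ g dμ` for all continuous `g`, where `g(A)` is the continuous functional
calculus (which only sees the values of `g` on the spectrum of `A`, a compact set of real
numbers). This determines the finite Borel measure `μ`. -/
def IsSpectralMeasure (A : EllTwo →L[ℂ] EllTwo) (ψ : EllTwo) (μ : Measure ℝ) : Prop :=
  IsFiniteMeasure μ ∧
    ∀ g : ℂ → ℂ, Continuous g → inner ℂ ψ (cfc g A ψ) = ∫ x : ℝ, g (x : ℂ) ∂μ

/-- `A` is self-adjoint and its spectral measure at every vector is absolutely continuous with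
respect to Lebesgue measure. -/
def PurelyAbsolutelyContinuousSpectrum (A : EllTwo →L[ℂ] EllTwo) : Prop :=
  IsSelfAdjoint A ∧
    ∀ ψ : EllTwo, ∃ μ : Measure ℝ, IsSpectralMeasure A ψ μ ∧ μ ≪ (volume : Measure ℝ)

/-- `‖xψ‖ < ∞`, where `(xψ)(n) = n ψ(n)`. -/
def HasFiniteDisplacement (ψ : EllTwo) : Prop :=
  Summable fun n : ℤ => (n : ℝ) ^ 2 * ‖ψ n‖ ^ 2

/-- The mean squared displacement `‖xψ‖²`. -/
def meanSquaredDisplacement (ψ : EllTwo) : ℝ :=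
  ∑' n : ℤ, (n : ℝ) ^ 2 * ‖ψ n‖ ^ 2

/-- The state `ψ` spreads out at ballistic speed: `‖x e^{-itA} ψ‖² / t²` is finite at all times
and has a finite nonzero limit as `t → ∞`. -/
def SpreadsBallistically (A : EllTwo →L[ℂ] EllTwo) (ψ : EllTwo) : Prop :=
  (∀ t : ℝ, HasFiniteDisplacement (evolution A t ψ)) ∧
    ∃ v : ℝ, 0 < v ∧
      Tendsto (fun t : ℝ => meanSquaredDisplacement (evolution A t ψ) / t ^ 2) atTop (𝓝 v)

/-- The dispersive estimate `‖e^{-itA} ψ‖_∞ ≤ C t^{-α} ‖ψ‖₁` for all `t > 0` and `ψ ∈ ℓ¹(ℤ)`,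
with a constant `C` that depends neither on `t` nor on `ψ`. -/
def Disperses (A : EllTwo →L[ℂ] EllTwo) (α : ℝ) : Prop :=
  ∃ C : ℝ, ∀ t : ℝ, 0 < t → ∀ ψ : EllTwo, (Summable fun n : ℤ => ‖ψ n‖) →
    supNorm (evolution A t ψ) ≤ C * t ^ (-α) * ∑' n : ℤ, ‖ψ n‖

/-- The eigenspace of `A` for the value `z`. -/
def eigenspaceOf (A : EllTwo →L[ℂ] EllTwo) (z : ℂ) : Submodule ℂ EllTwo :=
  Module.End.eigenspace (A : EllTwo →ₗ[ℂ] EllTwo) z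

end

/-! Fourier series turn `Γ.adjacency` into multiplication by the symbol h(x) = ∑ w(k) e^{2πikx} on
ℝ/ℤ, and the evolution into multiplication by e^{-ith}. So everything is read off from the shape of
h. For w(k) = k⁻², h is the parabola 2π²B₂(x). Removing the even edges cancels its quadratic term
and leaves a tent of slopes ∓π². Adding half of the tent composed with x ↦ 2x cancels the slopes on
[1/4, 3/4] and leaves a plateau.

The spectral measure at ψ is the image under h of |ψ̂|² dx. It is absolutely continuous when h is,
off the point 1/2, piecewise invertible with differentiable inverses (`ae_notMem_of_leftInvOn`).
With h' = 2πv, commuting position through the evolution gives x e^{-itA}ψ = e^{-itA}xψ - t·v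
e^{-ith}ψ. The first term has constant norm and the second has norm t‖vψ̂‖, so spreading is
ballistic if v ≠ 0 almost everywhere (`spreadsBallistically_contMultiplier`).

Dispersion concerns the kernel, the Fourier coefficients of e^{-ith}. For the parabola these are
Fresnel integrals, of size t^{-1/2} uniformly in n. For the lattice, the coefficient at m = 2t has a
degenerate stationary point and size t^{-1/3}. For the tent, each half contributes an elementary
integral that resonates at m = ±πt/2. For the third graph the plateau contributes amplitude 1/2 at
the origin for all times, and functions supported on it are eigenvectors. A finitely supported
eigenvector would be a trigonometric polynomial vanishing on an interval. -/

noncomputable section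

/-! ### Fourier multipliers on ℓ²(ℤ) -/

open AddCircle

/-- The `L²` space of the circle `ℝ / ℤ`. -/
abbrev CircleLTwo : Type := Lp ℂ 2 (haarAddCircle (T := (1 : ℝ)))

/-- The `L^∞` space of the circle `ℝ / ℤ`. -/
abbrev CircleLInf : Type := Lp ℂ ⊤ (haarAddCircle (T := (1 : ℝ)))

/-- The Fourier series `∑ₙ ψ(n) e_n` of an element of `ℓ²(ℤ)`. -/
abbrev fourierSeries (ψ : EllTwo) : CircleLTwo := (fourierBasis (T := (1 : ℝ))).repr.symm ψ

/-- Multiplication of square integrable functions by an essentially bounded function. -/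
def circleMul : CircleLInf →L[ℂ] CircleLTwo →L[ℂ] CircleLTwo :=
  (ContinuousLinearMap.mul ℂ ℂ).holderL haarAddCircle ⊤ 2 2

theorem coeFn_circleMul (g : CircleLInf) (f : CircleLTwo) :
    circleMul g f =ᵐ[haarAddCircle] fun x => g x * f x :=
  ContinuousLinearMap.coeFn_holder _ g f

/-- The Fourier multiplier on `ℓ²(ℤ)` with a given essentially bounded symbol. -/
def multiplier (g : CircleLInf) : EllTwo →L[ℂ] EllTwo :=
  ((fourierBasis (T := (1 : ℝ))).repr : CircleLTwo →L[ℂ] EllTwo) ∘L circleMul g ∘L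
    ((fourierBasis (T := (1 : ℝ))).repr.symm : EllTwo →L[ℂ] CircleLTwo)

theorem multiplier_eq (g : CircleLInf) (ψ : EllTwo) :
    multiplier g ψ = (fourierBasis (T := (1 : ℝ))).repr (circleMul g (fourierSeries ψ)) := rfl

theorem fourierSeries_multiplier (g : CircleLInf) (ψ : EllTwo) :
    fourierSeries (multiplier g ψ) = circleMul g (fourierSeries ψ) := by
  rw [multiplier_eq, fourierSeries, LinearIsometryEquiv.symm_apply_apply]

theorem fourierSeries_pointMass (j : ℤ) :
    fourierSeries (pointMass j) =ᵐ[haarAddCircle] fourier j := by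
  have h : fourierSeries (pointMass j) = fourierLp 2 j := by
    rw [← coe_fourierBasis, fourierSeries, LinearIsometryEquiv.symm_apply_eq,
      HilbertBasis.repr_self]
    rfl
  rw [h]
  exact coeFn_fourierLp 2 j

theorem multiplier_apply (g : CircleLInf) (ψ : EllTwo) (n : ℤ) :
    multiplier g ψ n = fourierCoeff (fun x => g x * fourierSeries ψ x) n := by
  rw [multiplier_eq, fourierBasis_repr]
  exact congrFun (fourierCoeff_congr_ae (coeFn_circleMul g _)) n

theorem fourierCoeff_mul_fourier (f : UnitAddCircle → ℂ) (j n : ℤ) :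
    fourierCoeff (fun x => f x * fourier j x) n = fourierCoeff f (n - j) := by
  refine integral_congr_ae (ae_of_all _ fun x => ?_)
  simp only [smul_eq_mul]
  rw [show -(n - j) = -n + j by ring, fourier_add]
  ring

theorem multiplier_pointMass (g : CircleLInf) (j n : ℤ) :
    multiplier g (pointMass j) n = fourierCoeff g (n - j) := by
  rw [multiplier_apply, ← fourierCoeff_mul_fourier]
  refine congrFun (fourierCoeff_congr_ae ?_) n
  filter_upwards [fourierSeries_pointMass j] with x hx
  rw [hx]

theorem pointMass_smul (c : ℂ) (j : ℤ) : c • pointMass j = lp.single 2 j c := by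
  rw [pointMass, ← lp.single_smul, smul_eq_mul, mul_one]

theorem hasSum_multiplier (g : CircleLInf) (ψ : EllTwo) (n : ℤ) :
    HasSum (fun j => ψ j * fourierCoeff g (n - j)) (multiplier g ψ n) := by
  have h := (lp.hasSum_single (p := 2) (by norm_num) ψ).mapL
    ((lp.evalCLM ℂ (fun _ : ℤ => ℂ) (p := 2) n).comp (multiplier g))
  have h2 : ∀ j, ((lp.evalCLM ℂ (fun _ : ℤ => ℂ) (p := 2) n).comp (multiplier g))
      (lp.single 2 j (ψ j)) = ψ j * fourierCoeff g (n - j) := fun j => by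
    rw [← pointMass_smul, map_smul, smul_eq_mul, ← multiplier_pointMass]
    rfl
  simp only [h2] at h
  exact h

/-- By Parseval only the modulus of the symbol matters, so unimodular factors such as `propagator`
can be dropped. -/
theorem norm_multiplier_congr {g g' : CircleLInf} {ψ : EllTwo}
    (h : ∀ᵐ x ∂haarAddCircle, ‖g x‖ = ‖g' x‖) : ‖multiplier g ψ‖ = ‖multiplier g' ψ‖ := by
  rw [multiplier_eq, multiplier_eq, LinearIsometryEquiv.norm_map, LinearIsometryEquiv.norm_map,
    Lp.norm_def, Lp.norm_def]
  congr 1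
  refine eLpNorm_congr_norm_ae ?_
  filter_upwards [coeFn_circleMul g (fourierSeries ψ), coeFn_circleMul g' (fourierSeries ψ), h]
    with x h1 h2 h3
  rw [h1, h2, norm_mul, norm_mul, h3]

theorem multiplier_ext {g : CircleLInf} {ψ φ : EllTwo}
    (h : ∀ᵐ x ∂haarAddCircle, fourierSeries φ x = g x * fourierSeries ψ x) :
    multiplier g ψ = φ := by
  rw [multiplier_eq, ← LinearIsometryEquiv.eq_symm_apply]
  refine Lp.ext ?_
  filter_upwards [coeFn_circleMul g (fourierSeries ψ), h] with x h1 h2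
  rw [h1, ← h2]

/-- Continuous functions as essentially bounded functions. -/
def toLInf : C(UnitAddCircle, ℂ) →L[ℂ] CircleLInf := ContinuousMap.toLp ⊤ haarAddCircle ℂ

theorem coeFn_toLInf (f : C(UnitAddCircle, ℂ)) : toLInf f =ᵐ[haarAddCircle] f :=
  ContinuousMap.coeFn_toLp _ f

theorem inner_eq_integral_fourierSeries (φ ψ : EllTwo) :
    inner ℂ φ ψ =
      ∫ x, inner ℂ (fourierSeries φ x) (fourierSeries ψ x) ∂haarAddCircle (T := (1 : ℝ)) := by
  rw [← L2.inner_def, fourierSeries, fourierSeries, LinearIsometryEquiv.inner_map_map]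

theorem fourierSeries_multiplier_toLInf (f : C(UnitAddCircle, ℂ)) (ψ : EllTwo) :
    fourierSeries (multiplier (toLInf f) ψ) =ᵐ[haarAddCircle] fun x => f x * fourierSeries ψ x := by
  rw [fourierSeries_multiplier]
  filter_upwards [coeFn_circleMul (toLInf f) (fourierSeries ψ), coeFn_toLInf f] with x h1 h2
  rw [h1, h2]

/-- The Fourier multipliers with continuous symbol form a commutative star algebra. -/
def contMultiplier : C(UnitAddCircle, ℂ) →⋆ₐ[ℂ] (EllTwo →L[ℂ] EllTwo) where
  toFun f := multiplier (toLInf f)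
  map_one' := by
    ext1 ψ
    refine multiplier_ext ?_
    filter_upwards [coeFn_toLInf 1] with x h
    rw [h]; simp
  map_mul' f g := by
    ext1 ψ
    refine multiplier_ext ?_
    rw [mul_apply_eq_comp]
    filter_upwards [coeFn_toLInf (f * g), fourierSeries_multiplier_toLInf g ψ,
      fourierSeries_multiplier_toLInf f (multiplier (toLInf g) ψ)] with x h h1 h2
    rw [h, h2, h1, ContinuousMap.mul_apply, mul_assoc]
  map_zero' := by
    ext1 ψ
    simp [multiplier]
  map_add' f g := by
    ext1 ψ
    simp [multiplier]
  commutes' c := by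
    ext1 ψ
    refine multiplier_ext ?_
    rw [ContinuousLinearMap.algebraMap_apply]
    filter_upwards [coeFn_toLInf (algebraMap ℂ _ c), Lp.coeFn_smul c (fourierSeries ψ)]
      with x h1 h2
    rw [h1, fourierSeries, map_smul, h2]
    simp
  map_star' f := by
    rw [ContinuousLinearMap.star_eq_adjoint, ContinuousLinearMap.eq_adjoint_iff]
    intro φ ψ
    rw [inner_eq_integral_fourierSeries, inner_eq_integral_fourierSeries]
    refine integral_congr_ae ?_
    filter_upwards [fourierSeries_multiplier_toLInf (star f) φ,
      fourierSeries_multiplier_toLInf f ψ] with x h1 h2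
    rw [h1, h2]
    simp [mul_left_comm, mul_assoc]

theorem contMultiplier_eq (f : C(UnitAddCircle, ℂ)) : contMultiplier f = multiplier (toLInf f) :=
  rfl

theorem continuous_contMultiplier : Continuous contMultiplier := by
  have h : Continuous fun g : CircleLInf => multiplier g := by
    have := circleMul.continuous
    unfold multiplier
    fun_prop
  exact h.comp toLInf.continuous

theorem fourierCoeff_toLInf (f : C(UnitAddCircle, ℂ)) (n : ℤ) :
    fourierCoeff (toLInf f) n = fourierCoeff f n :=
  congrFun (fourierCoeff_congr_ae (coeFn_toLInf f)) n

theorem contMultiplier_pointMass (f : C(UnitAddCircle, ℂ)) (j n : ℤ) :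
    contMultiplier f (pointMass j) n = fourierCoeff f (n - j) := by
  rw [contMultiplier_eq, multiplier_pointMass, fourierCoeff_toLInf]

theorem hasSum_contMultiplier (f : C(UnitAddCircle, ℂ)) (ψ : EllTwo) (n : ℤ) :
    HasSum (fun j => ψ j * fourierCoeff f (n - j)) (contMultiplier f ψ n) := by
  rw [contMultiplier_eq]
  simpa only [fourierCoeff_toLInf] using hasSum_multiplier (toLInf f) ψ n

/-- The sign is negative because ψ(n + k) moves ψ to the left. -/
theorem contMultiplier_fourier (k : ℤ) (ψ : EllTwo) :
    contMultiplier (fourier (-k)) ψ = EllTwo.translate k ψ := by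
  ext n
  have h := hasSum_contMultiplier (fourier (-k)) ψ n
  rw [EllTwo.translate_apply]
  refine h.unique ?_
  have h2 := hasSum_single (n + k) (f := fun j => ψ j * fourierCoeff (fourier (T := (1 : ℝ)) (-k))
    (n - j)) fun j hj => by
      rw [fourierCoeff_fourier, Pi.single_eq_of_ne (by omega), mul_zero]
  convert h2
  rw [fourierCoeff_fourier, show n - (n + k) = -k by ring, Pi.single_eq_same, mul_one]

/-- The functional calculus commutes with continuous star homomorphisms: with point evaluations,
which identify it with composition, and with `contMultiplier`. -/
theorem cfc_contMultiplier {f : C(UnitAddCircle, ℂ)} (hf : IsSelfAdjoint f) {g : ℂ → ℂ}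
    (hg : Continuous g) :
    cfc g (contMultiplier f) = contMultiplier ((⟨g, hg⟩ : C(ℂ, ℂ)).comp f) := by
  have h1 : cfc g f = (⟨g, hg⟩ : C(ℂ, ℂ)).comp f := by
    ext x
    have h := StarAlgHom.map_cfc (ContinuousMap.evalStarAlgHom ℂ ℂ x) g f hg.continuousOn
      (continuous_eval_const x) hf.isStarNormal
      (hf.map (ContinuousMap.evalStarAlgHom ℂ ℂ x)).isStarNormal
    refine h.trans ?_
    exact cfc_algebraMap (A := ℂ) (f x) g
  rw [← h1]
  exact (StarAlgHom.map_cfc contMultiplier g f hg.continuousOn continuous_contMultiplier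
    hf.isStarNormal (hf.map contMultiplier).isStarNormal).symm

/-! ### Adjacency operators as multipliers -/

namespace PeriodicGraph

theorem summable_symbol (Γ : PeriodicGraph) :
    Summable fun k : ℤ => (Γ.w k : ℂ) • fourier (T := (1 : ℝ)) (-k) := by
  refine Summable.of_norm ?_
  simpa [norm_smul, fourier_norm, abs_of_nonneg (Γ.w_nonneg _)] using Γ.w_summable

/-- The function on the circle with Fourier coefficients `w`. -/
def symbol (Γ : PeriodicGraph) : C(UnitAddCircle, ℂ) :=
  ∑' k : ℤ, (Γ.w k : ℂ) • fourier (-k)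

theorem hasSum_symbol (Γ : PeriodicGraph) (x : UnitAddCircle) :
    HasSum (fun k : ℤ => (Γ.w k : ℂ) * fourier k x) (Γ.symbol x) := by
  have h : HasSum (fun k : ℤ => (Γ.w k : ℂ) • fourier (-k) x) (Γ.symbol x) :=
    Γ.summable_symbol.hasSum.mapL (ContinuousMap.evalCLM ℂ x)
  -- The weights are even, so k ↦ -k removes the sign in the definition of `symbol`.
  rw [← (Equiv.neg ℤ).hasSum_iff] at h
  convert h using 2 with k
  simp [Γ.w_neg]

theorem isSelfAdjoint_symbol (Γ : PeriodicGraph) : IsSelfAdjoint Γ.symbol := by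
  ext x
  have h := (Γ.hasSum_symbol x).map (starRingEnd ℂ) Complex.continuous_conj
  rw [← (Equiv.neg ℤ).hasSum_iff] at h
  refine h.unique ?_
  convert Γ.hasSum_symbol x using 2 with k
  simp [Γ.w_neg]

theorem contMultiplier_symbol (Γ : PeriodicGraph) : contMultiplier Γ.symbol = Γ.adjacency := by
  ext ψ n
  rw [adjacency_apply]
  have h := (Γ.summable_symbol.hasSum.map contMultiplier continuous_contMultiplier).mapL
    ((lp.evalCLM ℂ (fun _ : ℤ => ℂ) (p := 2) n).comp
      (ContinuousLinearMap.apply ℂ EllTwo ψ))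
  have h2 : ∀ k : ℤ, ((lp.evalCLM ℂ (fun _ : ℤ => ℂ) (p := 2) n).comp
      (ContinuousLinearMap.apply ℂ EllTwo ψ)) (contMultiplier ((Γ.w k : ℂ) • fourier (-k))) =
      (Γ.w k : ℂ) * ψ (n + k) := fun k => by
    rw [map_smul, map_smul, ContinuousLinearMap.comp_apply,
      ContinuousLinearMap.apply_apply, contMultiplier_fourier, smul_eq_mul]
    rfl
  simp only [Function.comp_apply, h2] at h
  exact h.tsum_eq.symm

end PeriodicGraph

/-! ### Spectral measures and ballistic spreading for a general symbol -/

/-- The symbol `e^{-ith}` of the unitary group with symbol `h`. -/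
def propagator (h : C(UnitAddCircle, ℂ)) (t : ℝ) : C(UnitAddCircle, ℂ) :=
  ⟨fun x => Complex.exp (-(Complex.I * t) * h x), by fun_prop⟩

theorem propagator_apply (h : C(UnitAddCircle, ℂ)) (t : ℝ) (x : UnitAddCircle) :
    propagator h t x = Complex.exp (-(Complex.I * t) * h x) := rfl

theorem evolution_contMultiplier (h : C(UnitAddCircle, ℂ)) (t : ℝ) :
    evolution (contMultiplier h) t = contMultiplier (propagator h t) := by
  have h1 : NormedSpace.exp ((-(Complex.I * (t : ℂ))) • h) = propagator h t := by
    ext x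
    have := NormedSpace.map_exp (ContinuousMap.evalStarAlgHom ℂ ℂ x)
      (continuous_eval_const x) ((-(Complex.I * (t : ℂ))) • h)
    refine this.trans ?_
    rw [← Complex.exp_eq_exp_ℂ]
    rfl
  rw [evolution, ← h1, NormedSpace.map_exp contMultiplier continuous_contMultiplier, map_smul]

theorem conj_eq_of_isSelfAdjoint {h : C(UnitAddCircle, ℂ)} (hh : IsSelfAdjoint h)
    (x : UnitAddCircle) : ((h x).re : ℂ) = h x := by
  have := congrArg (fun f : C(UnitAddCircle, ℂ) => f x) hh.star_eq
  exact Complex.conj_eq_iff_re.1 this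

theorem norm_propagator {h : C(UnitAddCircle, ℂ)} (hh : IsSelfAdjoint h) (t : ℝ)
    (x : UnitAddCircle) : ‖propagator h t x‖ = 1 := by
  rw [propagator_apply, ← conj_eq_of_isSelfAdjoint hh, Complex.norm_exp]
  simp

/-- By Parseval ⟨ψ, g(A)ψ⟩ = ∫ g(h)|ψ̂|², so the spectral measure is the image under h of the
density |ψ̂|². `hnull` says that h pulls null sets back to null sets. -/
theorem purelyAbsolutelyContinuousSpectrum_contMultiplier {h : C(UnitAddCircle, ℂ)}
    (hh : IsSelfAdjoint h)
    (hnull : ∀ N : Set ℝ, volume N = 0 →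
      haarAddCircle (T := (1 : ℝ)) ((fun x => (h x).re) ⁻¹' N) = 0) :
    PurelyAbsolutelyContinuousSpectrum (contMultiplier h) := by
  refine ⟨hh.map contMultiplier, fun ψ => ?_⟩
  set F := fourierSeries ψ with hF
  have hm : Measurable fun x : UnitAddCircle => (h x).re := by fun_prop
  have hFm : Measurable fun x => ‖F x‖ ^ 2 := ((Lp.stronglyMeasurable F).norm.measurable.pow_const 2)
  have hint : Integrable (fun x => ‖F x‖ ^ 2) (haarAddCircle (T := (1 : ℝ))) :=
    (memLp_two_iff_integrable_sq_norm (Lp.aestronglyMeasurable F)).1 (Lp.memLp F)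
  have hfin := isFiniteMeasure_withDensity_ofReal hint.2
  refine ⟨(haarAddCircle.withDensity fun x => ENNReal.ofReal (‖F x‖ ^ 2)).map fun x => (h x).re,
    ⟨inferInstance, fun g hg => ?_⟩, ?_⟩
  · rw [integral_map hm.aemeasurable (by fun_prop),
      integral_withDensity_eq_integral_toReal_smul hFm.ennreal_ofReal
        (ae_of_all _ fun x => ENNReal.ofReal_lt_top), cfc_contMultiplier hh hg,
      inner_eq_integral_fourierSeries]
    refine integral_congr_ae ?_
    filter_upwards [fourierSeries_multiplier_toLInf ((⟨g, hg⟩ : C(ℂ, ℂ)).comp h) ψ] with x hx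
    rw [contMultiplier_eq, hx, ENNReal.toReal_ofReal (by positivity), conj_eq_of_isSelfAdjoint hh,
      RCLike.inner_apply, mul_assoc, Complex.mul_conj, Complex.normSq_eq_norm_sq, mul_comm,
      Complex.real_smul, ← hF]
    rfl
  · refine Measure.AbsolutelyContinuous.mk fun N hN h0 => ?_
    rw [Measure.map_apply hm hN]
    exact withDensity_absolutelyContinuous _ _ (hnull N h0)

theorem norm_contMultiplier_propagator {h : C(UnitAddCircle, ℂ)} (hh : IsSelfAdjoint h) (t : ℝ)
    (ψ : EllTwo) : ‖contMultiplier (propagator h t) ψ‖ = ‖ψ‖ := by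
  have h1 : contMultiplier 1 ψ = ψ := by rw [map_one]; rfl
  nth_rw 2 [← h1]
  refine norm_multiplier_congr ?_
  filter_upwards [coeFn_toLInf (propagator h t), coeFn_toLInf 1] with x h1 h2
  rw [h1, h2, norm_propagator hh]
  simp

theorem hasSum_norm_sq (ψ : EllTwo) : HasSum (fun n => ‖ψ n‖ ^ 2) (‖ψ‖ ^ 2) := by
  have := lp.hasSum_norm (p := 2) (by norm_num) ψ
  simpa using this

/-- `hcoeff` is the commutator of position with the evolution, written on kernels; it encodes h' =
2πv. Since v may jump, the velocity term needs an essentially bounded symbol rather than a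
continuous one. -/
theorem spreadsBallistically_contMultiplier {h : C(UnitAddCircle, ℂ)} (hh : IsSelfAdjoint h)
    {v : UnitAddCircle → ℂ} (hv : AEStronglyMeasurable v (haarAddCircle (T := (1 : ℝ)))) {C : ℝ}
    (hC : ∀ x, ‖v x‖ ≤ C) (hv0 : ∀ᵐ x ∂haarAddCircle (T := (1 : ℝ)), v x ≠ 0)
    (hcoeff : ∀ (t : ℝ) (n : ℤ), (n : ℂ) * fourierCoeff (propagator h t) n =
      -t * fourierCoeff (fun x => v x * propagator h t x) n)
    {ψ : EllTwo} (hψ : ψ ≠ 0) (hx : HasFiniteDisplacement ψ) :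
    SpreadsBallistically (contMultiplier h) ψ := by
  have hxmem : Memℓp (fun n : ℤ => (n : ℂ) * ψ n) 2 := by
    refine memℓp_gen ?_
    rw [HasFiniteDisplacement] at hx
    simpa [mul_pow] using hx
  set xψ : EllTwo := ⟨_, hxmem⟩
  have hD : ∀ t, MemLp (fun x => v x * propagator h t x) ⊤ (haarAddCircle (T := (1 : ℝ))) :=
    fun t => memLp_top_of_bound (hv.mul (propagator h t).continuous.aestronglyMeasurable) C
      (ae_of_all _ fun x => by rw [norm_mul, norm_propagator hh, mul_one]; exact hC x)
  set P : ℝ → EllTwo := fun t => multiplier (hD t).toLp ψ with hP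
  have hPn : ∀ t, ‖P t‖ = ‖P 0‖ := fun t => norm_multiplier_congr <| by
    filter_upwards [(hD t).coeFn_toLp, (hD 0).coeFn_toLp] with x h1 h2
    rw [h1, h2, norm_mul, norm_mul, norm_propagator hh, norm_propagator hh]
  have hP0 : 0 < ‖P 0‖ := by
    rw [norm_pos_iff]
    intro h0
    refine hψ ?_
    have h1 : fourierSeries (P 0) = 0 := by rw [h0, fourierSeries, map_zero]
    rw [hP, fourierSeries_multiplier] at h1
    have h2 : fourierSeries ψ = 0 := by
      refine Lp.ext ?_
      filter_upwards [hv0, (hD 0).coeFn_toLp, coeFn_circleMul (hD 0).toLp (fourierSeries ψ),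
        Lp.coeFn_zero ℂ 2 (haarAddCircle (T := (1 : ℝ)))] with x e1 e2 e3 e4
      rw [h1, e4, e2] at e3
      rw [e4]
      have : propagator h 0 x ≠ 0 := fun h => by simpa [h] using norm_propagator hh 0 x
      simpa [e1, this] using e3.symm
    rwa [fourierSeries, LinearIsometryEquiv.map_eq_zero_iff] at h2
  -- This is x e^{-itA}ψ, as `hXn` shows.
  set X : ℝ → EllTwo := fun t => contMultiplier (propagator h t) xψ - (t : ℂ) • P t with hX
  have hXn : ∀ t n, X t n = (n : ℂ) * contMultiplier (propagator h t) ψ n := by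
    intro t n
    have h1 := hasSum_contMultiplier (propagator h t) xψ n
    have h2 := (hasSum_multiplier (hD t).toLp ψ n).mul_left (t : ℂ)
    -- Write n = j + (n - j): the factor j goes to ψ, and n - j goes to the kernel, where `hcoeff`
    -- applies.
    have h3 : ∀ j, xψ j * fourierCoeff (propagator h t) (n - j) -
        t * (ψ j * fourierCoeff (hD t).toLp (n - j)) =
        n * (ψ j * fourierCoeff (propagator h t) (n - j)) := fun j => by
      have h3 := hcoeff t (n - j)
      rw [congrFun (fourierCoeff_congr_ae (hD t).coeFn_toLp) (n - j)]
      have h4 : xψ j = (j : ℂ) * ψ j := rfl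
      rw [h4]
      push_cast at h3
      linear_combination (-ψ j) * h3
    have h4 := h1.sub h2
    simp only [h3] at h4
    exact h4.unique ((hasSum_contMultiplier (propagator h t) ψ n).mul_left (n : ℂ))
  have hsum : ∀ t, HasSum (fun n : ℤ => (n : ℝ) ^ 2 * ‖evolution (contMultiplier h) t ψ n‖ ^ 2)
      (‖X t‖ ^ 2) := fun t => by
    rw [evolution_contMultiplier]
    convert hasSum_norm_sq (X t) using 2 with n
    rw [hXn, norm_mul, mul_pow]
    simp
  refine ⟨fun t => (hsum t).summable, ‖P 0‖ ^ 2, by positivity, ?_⟩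
  have hlim : Tendsto (fun t : ℝ => ‖X t‖ / t) atTop (𝓝 ‖P 0‖) := by
    rw [tendsto_iff_norm_sub_tendsto_zero]
    refine squeeze_zero' (Eventually.of_forall fun t => norm_nonneg _)
      ((eventually_gt_atTop (0 : ℝ)).mono fun t ht => ?_)
      ((tendsto_const_nhds (x := ‖xψ‖)).div_atTop tendsto_id)
    have h1 : ‖X t‖ / t - ‖P 0‖ = (‖X t‖ - ‖(t : ℂ) • P t‖) / t := by
      rw [norm_smul, Complex.norm_real, Real.norm_of_nonneg ht.le, hPn t]
      field_simp
    rw [h1, norm_div, Real.norm_of_nonneg ht.le, id]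
    gcongr
    rw [Real.norm_eq_abs, ← norm_neg ((t : ℂ) • P t)]
    refine (abs_norm_sub_norm_le _ _).trans (le_of_eq ?_)
    rw [← norm_contMultiplier_propagator hh t xψ]
    simp only [hX, sub_neg_eq_add, sub_add_cancel]
  convert hlim.pow 2 using 2 with t
  rw [meanSquaredDisplacement, (hsum t).tsum_eq, div_pow]

theorem fourierCoeff_eq_integral_unit (f : UnitAddCircle → ℂ) (n : ℤ) :
    fourierCoeff f n =
      ∫ x in (0 : ℝ)..1, fourier (T := (1 : ℝ)) (-n) (x : UnitAddCircle) * f (x : UnitAddCircle) := by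
  rw [fourierCoeff_eq_intervalIntegral f n 0]
  simp

/-- Integrate the derivative of e_{-n} e^{-ith} over one period; the boundary terms cancel. Right
derivatives suffice, which admits the corner of the tent. -/
theorem mul_fourierCoeff_propagator {h : C(UnitAddCircle, ℂ)} {v : UnitAddCircle → ℂ}
    (hv : Measurable v) {C : ℝ} (hC : ∀ x, ‖v x‖ ≤ C)
    (hder : ∀ x ∈ Set.Ioo (0 : ℝ) 1, HasDerivWithinAt (fun y : ℝ => h (y : UnitAddCircle))
      (2 * Real.pi * v (x : UnitAddCircle)) (Set.Ioi x) x) (t : ℝ) (n : ℤ) :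
    (n : ℂ) * fourierCoeff (propagator h t) n =
      -t * fourierCoeff (fun x => v x * propagator h t x) n := by
  have hcoe : Continuous fun y : ℝ => (y : UnitAddCircle) := AddCircle.continuous_mk' 1
  set e : ℝ → ℂ := fun y => fourier (T := (1 : ℝ)) (-n) (y : UnitAddCircle) with he
  set p : ℝ → ℂ := fun y => propagator h t (y : UnitAddCircle) with hp
  have hec : Continuous e := (fourier (T := (1 : ℝ)) (-n)).continuous.comp hcoe
  have hpc : Continuous p := (propagator h t).continuous.comp hcoe
  have hi1 : IntervalIntegrable (fun x => e x * p x) volume 0 1 :=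
    (hec.mul hpc).intervalIntegrable _ _
  have hi2 : IntervalIntegrable (fun x : ℝ => e x * (v x * p x)) volume 0 1 := by
    have : IntervalIntegrable (fun x : ℝ => v x) volume 0 1 := by
      rw [intervalIntegrable_iff]
      refine Measure.integrableOn_of_bounded (M := C) (by simp) ?_ (ae_of_all _ fun x => hC x)
      exact (hv.comp hcoe.measurable).aestronglyMeasurable
    exact (this.mul_continuousOn hpc.continuousOn).continuousOn_mul hec.continuousOn
  have key := intervalIntegral.integral_eq_sub_of_hasDeriv_right (a := 0) (b := 1)
    (f := fun x => e x * p x)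
    (f' := fun x => (-2 * Real.pi * Complex.I * n) * (e x * p x) +
      (-(Complex.I * t) * (2 * Real.pi)) * (e x * (v x * p x)))
    (hec.mul hpc).continuousOn
    (fun x hx => by
      rw [min_eq_left zero_le_one, max_eq_right zero_le_one] at hx
      have h1 : HasDerivAt e (-2 * Real.pi * Complex.I * n * e x) x := by
        simpa only [Complex.ofReal_one, div_one] using hasDerivAt_fourier_neg 1 n x
      have h2 : HasDerivWithinAt p (p x * (-(Complex.I * t) * (2 * Real.pi * v x))) (Set.Ioi x) x :=
        ((hder x hx).const_mul _).cexp
      refine (h1.hasDerivWithinAt.mul h2).congr_deriv ?_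
      ring)
    ((hi1.const_mul _).add (hi2.const_mul _))
  rw [intervalIntegral.integral_add (hi1.const_mul _) (hi2.const_mul _),
    intervalIntegral.integral_const_mul, intervalIntegral.integral_const_mul] at key
  have hper : e 1 * p 1 - e 0 * p 0 = 0 := by
    simp only [he, hp]
    rw [AddCircle.coe_period, ← AddCircle.coe_zero, sub_self]
  rw [hper] at key
  rw [fourierCoeff_eq_integral_unit, fourierCoeff_eq_integral_unit]
  have h2 : (2 * Real.pi * Complex.I : ℂ) ≠ 0 := Complex.two_pi_I_ne_zero
  refine mul_left_cancel₀ h2 ?_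
  linear_combination -key

theorem haarAddCircle_one : haarAddCircle (T := (1 : ℝ)) = volume := by
  rw [volume_eq_smul_haarAddCircle]
  simp

theorem ae_circle_of_ae {p : UnitAddCircle → Prop} (hp : MeasurableSet {y | p y})
    (h : ∀ᵐ x : ℝ, x ∈ Set.Ioc (0 : ℝ) 1 → p (x : UnitAddCircle)) :
    ∀ᵐ y ∂haarAddCircle (T := (1 : ℝ)), p y := by
  have hm := UnitAddCircle.measurePreserving_mk 0
  rw [haarAddCircle_one, ← hm.map_eq, ae_map_iff hm.measurable.aemeasurable hp,
    ae_restrict_iff' measurableSet_Ioc]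
  simpa using h

/-- The exceptional points lie in the image under G of a part of N, and differentiable maps preserve
null sets. -/
theorem ae_notMem_of_leftInvOn {s N : Set ℝ} {H G : ℝ → ℝ} (hN : volume N = 0)
    (hinv : Set.LeftInvOn G H s) (hG : DifferentiableOn ℝ G (H '' s)) :
    ∀ᵐ x, x ∈ s → H x ∉ N := by
  have h := addHaar_image_eq_zero_of_differentiableOn_of_addHaar_eq_zero volume
    (hG.mono Set.inter_subset_left) (measure_mono_null (Set.inter_subset_right (s := H '' s)) hN)
  filter_upwards [compl_mem_ae_iff.2 h] with x hx hxs hxN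
  exact hx ⟨H x, ⟨⟨x, hxs, rfl⟩, hxN⟩, hinv hxs⟩

theorem haar_preimage_re_eq_zero {h : C(UnitAddCircle, ℂ)} {H : ℝ → ℝ}
    (hH : ∀ x ∈ Set.Icc (0 : ℝ) 1, h (x : UnitAddCircle) = H x)
    (hnull : ∀ N : Set ℝ, volume N = 0 → ∀ᵐ x, x ∈ Set.Ioo (0 : ℝ) (1 / 2) ∪ Set.Ioo (1 / 2) 1 →
      H x ∉ N) (N : Set ℝ) (hN : volume N = 0) :
    haarAddCircle (T := (1 : ℝ)) ((fun x => (h x).re) ⁻¹' N) = 0 := by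
  have hm : Measurable fun x : UnitAddCircle => (h x).re := by fun_prop
  -- N need not be measurable, so its measurable hull is used instead.
  have h1 : ∀ᵐ y ∂haarAddCircle (T := (1 : ℝ)), (h y).re ∉ toMeasurable volume N := by
    refine ae_circle_of_ae (hm (measurableSet_toMeasurable volume N).compl) ?_
    have hfin : volume ({1 / 2, 1} : Set ℝ) = 0 := (Set.toFinite _).measure_zero _
    filter_upwards [hnull _ ((measure_toMeasurable N).trans hN), compl_mem_ae_iff.2 hfin]
      with x hx hx2 hx3
    simp only [Set.mem_compl_iff, Set.mem_insert_iff, Set.mem_singleton_iff, not_or] at hx2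
    rw [hH x ⟨hx3.1.le, hx3.2⟩, Complex.ofReal_re]
    refine hx ?_
    rcases lt_or_gt_of_ne hx2.1 with h | h
    · exact Or.inl ⟨hx3.1, h⟩
    · exact Or.inr ⟨h, lt_of_le_of_ne hx3.2 hx2.2⟩
  refine measure_mono_null (fun x hx => ?_) h1
  simpa using subset_toMeasurable volume N hx

/-- The representative of a point of the circle in `[0, 1)`. -/
def circleFrac (y : UnitAddCircle) : ℝ := measurableEquivIco 1 0 y

theorem measurable_circleFrac : Measurable circleFrac :=
  measurable_subtype_coe.comp (measurableEquivIco 1 0).measurable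

theorem circleFrac_mem (y : UnitAddCircle) : circleFrac y ∈ Set.Ico (0 : ℝ) 1 := by
  have := (measurableEquivIco 1 0 y).2
  exact ⟨this.1, this.2.trans_eq (zero_add 1)⟩

theorem circleFrac_coe {x : ℝ} (hx : x ∈ Set.Ico (0 : ℝ) 1) :
    circleFrac (x : UnitAddCircle) = x :=
  equivIco_coe_of_mem (p := (1 : ℝ)) (a := 0) (by rwa [zero_add])

/-- The point 1/2 is singled out because the parabola has its vertex there and the tent its corner.
-/
theorem spectral_and_ballistic {Γ : PeriodicGraph} {H v : ℝ → ℝ}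
    (hH : ∀ x ∈ Set.Icc (0 : ℝ) 1, Γ.symbol (x : UnitAddCircle) = H x)
    (hnull : ∀ N : Set ℝ, volume N = 0 → ∀ᵐ x, x ∈ Set.Ioo (0 : ℝ) (1 / 2) ∪ Set.Ioo (1 / 2) 1 →
      H x ∉ N)
    (hv : Measurable v) {C : ℝ} (hC : ∀ x ∈ Set.Ico (0 : ℝ) 1, |v x| ≤ C)
    (hv0 : ∀ x, x ≠ 1 / 2 → v x ≠ 0)
    (hder : ∀ x ∈ Set.Ioo (0 : ℝ) 1, HasDerivWithinAt H (2 * Real.pi * v x) (Set.Ioi x) x) :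
    PurelyAbsolutelyContinuousSpectrum Γ.adjacency ∧
      ∀ ψ : EllTwo, ψ ≠ 0 → HasFiniteDisplacement ψ → SpreadsBallistically Γ.adjacency ψ := by
  rw [← Γ.contMultiplier_symbol]
  refine ⟨purelyAbsolutelyContinuousSpectrum_contMultiplier Γ.isSelfAdjoint_symbol
    (haar_preimage_re_eq_zero hH hnull), fun ψ h1 h2 => ?_⟩
  have hvm : Measurable fun y : UnitAddCircle => (v (circleFrac y) : ℂ) :=
    Complex.measurable_ofReal.comp (hv.comp measurable_circleFrac)
  have hvC : ∀ y : UnitAddCircle, ‖(v (circleFrac y) : ℂ)‖ ≤ C := fun y => by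
    rw [Complex.norm_real]
    exact hC _ (circleFrac_mem y)
  refine spreadsBallistically_contMultiplier Γ.isSelfAdjoint_symbol hvm.aestronglyMeasurable hvC
    ?_ (mul_fourierCoeff_propagator hvm hvC fun x hx => ?_) h1 h2
  · refine ae_circle_of_ae (hvm (measurableSet_singleton (0 : ℂ)).compl) ?_
    have hfin : volume ({1 / 2, 1} : Set ℝ) = 0 := (Set.toFinite _).measure_zero _
    filter_upwards [compl_mem_ae_iff.2 hfin] with x hx2 hx3
    simp only [Set.mem_compl_iff, Set.mem_insert_iff, Set.mem_singleton_iff, not_or] at hx2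
    rw [circleFrac_coe ⟨hx3.1.le, lt_of_le_of_ne hx3.2 hx2.2⟩, Complex.ofReal_ne_zero]
    exact hv0 x hx2.1
  · rw [circleFrac_coe ⟨hx.1.le, hx.2⟩]
    have h3 := (hder x hx).ofReal_comp
    push_cast at h3
    refine h3.congr_of_eventuallyEq ?_ (hH x ⟨hx.1.le, hx.2.le⟩)
    filter_upwards [Ioo_mem_nhdsGT hx.2] with y hy
    exact hH y ⟨hx.1.le.trans hy.1.le, hy.2.le⟩

/-! ### The three symbols: parabola, tent, plateau -/

theorem symbol_fullGraph {x : ℝ} (hx : x ∈ Set.Icc (0 : ℝ) 1) :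
    fullGraph.symbol (x : UnitAddCircle) =
      ((2 * Real.pi ^ 2 * (x ^ 2 - x + 1 / 6) : ℝ) : ℂ) := by
  have h := hasSum_one_div_pow_mul_fourier_mul_bernoulliFun le_rfl hx
  -- At n = 0 the convention 1 / 0 = 0 agrees with the missing loop.
  have h2 : ∀ n : ℤ, (fullGraph.w n : ℂ) = 1 / (n : ℂ) ^ 2 := fun n => by
    change ((if n = 0 then 0 else 1 / (n : ℝ) ^ 2 : ℝ) : ℂ) = _
    split_ifs with h
    · simp [h]
    · push_cast; rfl
  simp only [← h2] at h
  rw [(fullGraph.hasSum_symbol x).unique h, bernoulliFun_two]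
  push_cast
  rw [mul_pow, Complex.I_sq, Nat.factorial_two]
  push_cast
  ring

/-- Composition with y ↦ 2y spreads the weights out onto the even integers. -/
theorem hasSum_symbol_two_nsmul (Γ : PeriodicGraph) (y : UnitAddCircle) :
    HasSum (fun k : ℤ => if k % 2 = 0 then (Γ.w (k / 2) : ℂ) * fourier k y else 0)
      (Γ.symbol (2 • y)) := by
  have h := Γ.hasSum_symbol (2 • y)
  rw [← (Function.Injective.hasSum_iff (g := fun k : ℤ => 2 * k)
    (fun a b (hab : 2 * a = 2 * b) => by omega) ?_)]
  · convert h using 2 with k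
    have h1 : 2 * k % 2 = 0 := by omega
    have h2 : 2 * k / 2 = k := by omega
    simp only [Function.comp_apply, h1, h2, if_true, fourier_apply]
    congr 3
    rw [mul_comm, mul_zsmul]
    norm_cast
  · intro k hk
    refine if_neg fun h => hk ⟨k / 2, ?_⟩
    change 2 * (k / 2) = k
    omega

/-- The even edges have (2j)⁻² = j⁻²/4, so they form a rescaled copy of the full graph. -/
theorem symbol_oddGraph_eq (y : UnitAddCircle) :
    oddGraph.symbol y = fullGraph.symbol y - 1 / 4 * fullGraph.symbol (2 • y) := by
  have h := (fullGraph.hasSum_symbol y).sub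
    ((hasSum_symbol_two_nsmul fullGraph y).mul_left (1 / 4))
  refine (oddGraph.hasSum_symbol y).unique (h.congr_fun fun k => ?_)
  obtain ⟨j, rfl | rfl⟩ : ∃ j : ℤ, k = 2 * j ∨ k = 2 * j + 1 := ⟨k / 2, by omega⟩
  · have h1 : oddGraph.w (2 * j) = 0 := if_neg (by omega)
    have h2 : fullGraph.w (2 * j) = 1 / 4 * fullGraph.w j := by
      simp only [fullGraph]
      by_cases hj : j = 0
      · simp [hj]
      · rw [if_neg hj, if_neg (by omega)]
        push_cast
        field_simp
        norm_num
    rw [if_pos (by omega), h1, h2, show 2 * j / 2 = j by omega]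
    push_cast
    ring
  · have h1 : oddGraph.w (2 * j + 1) = fullGraph.w (2 * j + 1) := by
      simp only [oddGraph, fullGraph]
      rw [if_pos (by omega), if_neg (by omega)]
    rw [if_neg (by omega), h1]
    ring

/-- For odd j the edge 2j has weight 2(2j)⁻² = j⁻²/2, half of an odd edge. -/
theorem symbol_modFourGraph_eq (y : UnitAddCircle) :
    modFourGraph.symbol y = oddGraph.symbol y + 1 / 2 * oddGraph.symbol (2 • y) := by
  have h := (oddGraph.hasSum_symbol y).add
    ((hasSum_symbol_two_nsmul oddGraph y).mul_left (1 / 2))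
  refine (modFourGraph.hasSum_symbol y).unique (h.congr_fun fun k => ?_)
  obtain ⟨j, rfl | rfl⟩ : ∃ j : ℤ, k = 2 * j ∨ k = 2 * j + 1 := ⟨k / 2, by omega⟩
  · have h1 : oddGraph.w (2 * j) = 0 := if_neg (by omega)
    have h2 : modFourGraph.w (2 * j) = 1 / 2 * oddGraph.w j := by
      simp only [modFourGraph, oddGraph]
      rw [if_neg (by omega)]
      by_cases hj : j % 2 = 1
      · rw [if_pos hj, if_pos (by omega)]
        push_cast
        field_simp
      · rw [if_neg hj, if_neg (by omega), mul_zero]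
    rw [if_pos (by omega), h1, h2, show 2 * j / 2 = j by omega]
    push_cast
    ring
  · have h1 : modFourGraph.w (2 * j + 1) = oddGraph.w (2 * j + 1) := by
      simp only [modFourGraph, oddGraph]
      rw [if_pos (by omega), if_pos (by omega)]
    rw [if_neg (by omega), h1]
    ring

theorem two_nsmul_coe (x : ℝ) : 2 • (x : UnitAddCircle) = ((2 * x : ℝ) : UnitAddCircle) := by
  rw [← AddCircle.coe_nsmul]; simp

theorem two_nsmul_coe_sub_one (x : ℝ) : 2 • (x : UnitAddCircle) = ((2 * x - 1 : ℝ) : UnitAddCircle) := by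
  rw [two_nsmul_coe, AddCircle.coe_sub, AddCircle.coe_period, sub_zero]

/-- The quadratic terms cancel, as x² - (2x)²/4 = 0. -/
theorem symbol_oddGraph_left {x : ℝ} (hx : x ∈ Set.Icc (0 : ℝ) (1 / 2)) :
    oddGraph.symbol (x : UnitAddCircle) = ((Real.pi ^ 2 / 4 - Real.pi ^ 2 * x : ℝ) : ℂ) := by
  rw [symbol_oddGraph_eq, two_nsmul_coe, symbol_fullGraph ⟨hx.1, by linarith [hx.2]⟩,
    symbol_fullGraph ⟨by linarith [hx.1], by linarith [hx.2]⟩]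
  push_cast
  ring

theorem symbol_oddGraph_right {x : ℝ} (hx : x ∈ Set.Icc (1 / 2 : ℝ) 1) :
    oddGraph.symbol (x : UnitAddCircle) = ((Real.pi ^ 2 / 4 - Real.pi ^ 2 * (1 - x) : ℝ) : ℂ) := by
  rw [symbol_oddGraph_eq, two_nsmul_coe_sub_one, symbol_fullGraph ⟨by linarith [hx.1], hx.2⟩,
    symbol_fullGraph ⟨by linarith [hx.1], by linarith [hx.2]⟩]
  push_cast
  ring

theorem symbol_oddGraph {x : ℝ} (hx : x ∈ Set.Icc (0 : ℝ) 1) :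
    oddGraph.symbol (x : UnitAddCircle) =
      ((Real.pi ^ 2 / 4 - Real.pi ^ 2 * (if x < 1 / 2 then x else 1 - x) : ℝ) : ℂ) := by
  split_ifs with h
  · exact symbol_oddGraph_left ⟨hx.1, h.le⟩
  · exact symbol_oddGraph_right ⟨not_lt.1 h, hx.2⟩

/-! ### Spectrum and ballistic spreading for parabola and tent -/

theorem spectral_and_ballistic_fullGraph :
    PurelyAbsolutelyContinuousSpectrum fullGraph.adjacency ∧
      ∀ ψ : EllTwo, ψ ≠ 0 → HasFiniteDisplacement ψ →
        SpreadsBallistically fullGraph.adjacency ψ := by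
  have hpi := Real.pi_pos
  refine spectral_and_ballistic (v := fun x => Real.pi * (2 * x - 1)) (C := Real.pi)
    (fun x hx => symbol_fullGraph hx) (fun N hN => ?_) (by fun_prop) (fun x hx => ?_)
    (fun x hx => ?_) (fun x hx => ?_)
  -- Completing the square: the two branches of the inverse are 1/2 ∓ √(y/(2π²) + 1/12),
  -- differentiable away from the vertex.
  · have hval : ∀ x : ℝ, 2 * Real.pi ^ 2 * (x ^ 2 - x + 1 / 6) / (2 * Real.pi ^ 2) + 1 / 12 =
        (x - 1 / 2) ^ 2 := fun x => by field_simp; ring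
    have hdiff : ∀ s : Set ℝ, (∀ x ∈ s, x ≠ 1 / 2) → DifferentiableOn ℝ
        (fun y => √(y / (2 * Real.pi ^ 2) + 1 / 12))
        ((fun x => 2 * Real.pi ^ 2 * (x ^ 2 - x + 1 / 6)) '' s) := by
      rintro s hs _ ⟨x, hx, rfl⟩
      have h0 : 2 * Real.pi ^ 2 * (x ^ 2 - x + 1 / 6) / (2 * Real.pi ^ 2) + 1 / 12 ≠ 0 := by
        rw [hval]
        exact pow_ne_zero 2 (sub_ne_zero.2 (hs x hx))
      exact DifferentiableAt.differentiableWithinAt (DifferentiableAt.sqrt (by fun_prop) h0)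
    have h1 := ae_notMem_of_leftInvOn (s := Set.Ioo (0 : ℝ) (1 / 2)) hN
      (H := fun x => 2 * Real.pi ^ 2 * (x ^ 2 - x + 1 / 6))
      (G := fun y => 1 / 2 - √(y / (2 * Real.pi ^ 2) + 1 / 12))
      (fun x hx => by
        simp only [hval]
        rw [Real.sqrt_sq_eq_abs, abs_of_neg (by linarith [hx.2])]; ring)
      ((hdiff _ fun x hx => hx.2.ne).const_sub _)
    have h2 := ae_notMem_of_leftInvOn (s := Set.Ioo (1 / 2 : ℝ) 1) hN
      (H := fun x => 2 * Real.pi ^ 2 * (x ^ 2 - x + 1 / 6))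
      (G := fun y => 1 / 2 + √(y / (2 * Real.pi ^ 2) + 1 / 12))
      (fun x hx => by
        simp only [hval]
        rw [Real.sqrt_sq_eq_abs, abs_of_pos (by linarith [hx.1])]; ring)
      ((hdiff _ fun x hx => hx.1.ne').const_add _)
    filter_upwards [h1, h2] with x h1 h2 hx
    exact hx.elim h1 h2
  · rw [abs_mul, abs_of_pos hpi]
    exact mul_le_of_le_one_right hpi.le (abs_le.2 ⟨by linarith [hx.1], by linarith [hx.2]⟩)
  · exact mul_ne_zero hpi.ne' fun h => hx (by linarith)
  · refine HasDerivAt.hasDerivWithinAt ?_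
    refine ((((hasDerivAt_pow 2 x).sub (hasDerivAt_id x)).add_const (1 / 6)).const_mul
      (2 * Real.pi ^ 2)).congr_deriv ?_
    simp
    ring

theorem spectral_and_ballistic_oddGraph :
    PurelyAbsolutelyContinuousSpectrum oddGraph.adjacency ∧
      ∀ ψ : EllTwo, ψ ≠ 0 → HasFiniteDisplacement ψ →
        SpreadsBallistically oddGraph.adjacency ψ := by
  have hpi := Real.pi_pos
  refine spectral_and_ballistic (v := fun x => if x < 1 / 2 then -Real.pi / 2 else Real.pi / 2)
    (C := Real.pi / 2)
    (fun x hx => symbol_oddGraph hx) (fun N hN => ?_)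
    (Measurable.ite measurableSet_Iio measurable_const measurable_const) (fun x hx => ?_)
    (fun x hx => ?_) (fun x hx => ?_)
  · have h1 := ae_notMem_of_leftInvOn (s := Set.Ioo (0 : ℝ) (1 / 2)) hN
      (H := fun x => Real.pi ^ 2 / 4 - Real.pi ^ 2 * (if x < 1 / 2 then x else 1 - x))
      (G := fun y => 1 / 4 - y / Real.pi ^ 2)
      (fun x hx => by
        simp only [if_pos hx.2]
        field_simp; ring) (by fun_prop)
    have h2 := ae_notMem_of_leftInvOn (s := Set.Ioo (1 / 2 : ℝ) 1) hN
      (H := fun x => Real.pi ^ 2 / 4 - Real.pi ^ 2 * (if x < 1 / 2 then x else 1 - x))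
      (G := fun y => 3 / 4 + y / Real.pi ^ 2)
      (fun x hx => by
        simp only [if_neg hx.1.le.not_gt]
        field_simp; ring) (by fun_prop)
    filter_upwards [h1, h2] with x h1 h2 hx
    exact hx.elim h1 h2
  · split_ifs
    · rw [abs_of_neg (by linarith)]; linarith
    · rw [abs_of_pos (by linarith)]
  · split_ifs
    · exact (by linarith : -Real.pi / 2 < 0).ne
    · exact (by linarith : 0 < Real.pi / 2).ne'
  -- The corner 1/2 belongs to the second case, where v takes the right-hand slope.
  · by_cases h : x < 1 / 2
    · simp only [if_pos h]
      have h1 : HasDerivAt (fun x => Real.pi ^ 2 / 4 - Real.pi ^ 2 * x)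
          (2 * Real.pi * (-Real.pi / 2)) x :=
        (((hasDerivAt_id x).const_mul (Real.pi ^ 2)).const_sub (Real.pi ^ 2 / 4)).congr_deriv
          (by ring)
      refine h1.hasDerivWithinAt.congr_of_eventuallyEq ?_ (by simp only [if_pos h])
      filter_upwards [Ioo_mem_nhdsGT h] with y hy
      simp only [if_pos hy.2]
    · simp only [if_neg h]
      have h1 : HasDerivAt (fun x => Real.pi ^ 2 / 4 - Real.pi ^ 2 * (1 - x))
          (2 * Real.pi * (Real.pi / 2)) x :=
        ((((hasDerivAt_id x).const_sub 1).const_mul (Real.pi ^ 2)).const_sub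
          (Real.pi ^ 2 / 4)).congr_deriv (by ring)
      refine h1.hasDerivWithinAt.congr_of_eventuallyEq ?_ (by simp only [if_neg h])
      filter_upwards [self_mem_nhdsWithin] with y hy
      simp only [if_neg (not_lt.2 ((not_lt.1 h).trans (le_of_lt hy)))]

/-! ### The odd graph: two tents and failure of dispersion -/

theorem evolution_pointMass_apply (Γ : PeriodicGraph) (t : ℝ) (n m : ℤ) :
    evolution Γ.adjacency t (pointMass n) m = fourierCoeff (propagator Γ.symbol t) (m - n) := by
  rw [← Γ.contMultiplier_symbol, evolution_contMultiplier, contMultiplier_pointMass]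

theorem norm_apply_le_supNorm (ψ : EllTwo) (n : ℤ) : ‖ψ n‖ ≤ supNorm ψ :=
  le_ciSup (bddAbove_norm_range ψ) n

theorem evolution_zero (A : EllTwo →L[ℂ] EllTwo) (ψ : EllTwo) : evolution A 0 ψ = ψ := by
  simp [evolution, NormedSpace.exp_zero]

theorem norm_pointMass_apply (j : ℤ) :
    (fun n : ℤ => ‖pointMass j n‖) = Pi.single j 1 := by
  ext n
  rw [pointMass, lp.single_apply]
  by_cases h : n = j
  · subst h; simp
  · simp [h]

/-- The point mass has ℓ¹ norm 1, while C t^{-α} tends to 0. -/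
theorem not_disperses_of_le {A : EllTwo →L[ℂ] EllTwo} {c : ℝ} (hc : 0 < c)
    (h : ∀ t : ℝ, 0 ≤ t → c ≤ supNorm (evolution A t (pointMass 0))) {α : ℝ} (hα : 0 < α) :
    ¬ Disperses A α := by
  rintro ⟨C, hC⟩
  have h1 : ∀ t : ℝ, 0 < t → c ≤ C * t ^ (-α) := fun t ht => by
    have h2 := (h t ht.le).trans (hC t ht (pointMass 0) (by
      rw [norm_pointMass_apply]
      exact (hasSum_pi_single _ _).summable))
    rwa [norm_pointMass_apply, tsum_pi_single, mul_one] at h2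
  have h2 := (tendsto_rpow_neg_atTop hα).const_mul C
  rw [mul_zero] at h2
  exact hc.not_ge (ge_of_tendsto h2 ((eventually_gt_atTop 0).mono h1))

/-- The integral of `e^{ibx}` over half a period. -/
def halfWave (b : ℝ) : ℂ := ∫ x in (0 : ℝ)..1 / 2, Complex.exp (Complex.I * b * x)

theorem halfWave_zero : halfWave 0 = 1 / 2 := by
  simp [halfWave]

theorem halfWave_eq {b : ℝ} (hb : b ≠ 0) :
    halfWave b = (Complex.exp (Complex.I * (b / 2 : ℝ)) - 1) / (Complex.I * b) := by
  rw [halfWave, integral_exp_mul_complex (by simp [hb])]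
  push_cast
  simp only [mul_zero, Complex.exp_zero]
  congr 3
  ring

theorem halfWave_neg (b : ℝ) : halfWave (-b) = starRingEnd ℂ (halfWave b) := by
  by_cases hb : b = 0
  · simp [hb, halfWave_zero, map_ofNat]
  · rw [halfWave_eq hb, halfWave_eq (neg_ne_zero.2 hb), map_div₀, map_sub, ← Complex.exp_conj]
    simp [neg_div, map_ofNat]

/-- The modulus of the two-tent profile at the scaled time `s = πt/2` and at distance `m`. -/
def tents (s : ℝ) (m : ℤ) : ℝ :=
  ‖halfWave (2 * Real.pi * (s - m)) + halfWave (2 * Real.pi * (s + m))‖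

theorem tents_neg_right (s : ℝ) (m : ℤ) : tents s (-m) = tents s m := by
  rw [tents, tents, add_comm]
  push_cast
  simp only [sub_neg_eq_add, ← sub_eq_add_neg]

theorem tents_neg_left (s : ℝ) (m : ℤ) : tents (-s) m = tents s m := by
  rw [tents, tents, show 2 * Real.pi * (-s - m) = -(2 * Real.pi * (s + m)) by ring,
    show 2 * Real.pi * (-s + m) = -(2 * Real.pi * (s - m)) by ring, halfWave_neg, halfWave_neg,
    ← map_add, Complex.norm_conj, add_comm]

/-- The phase is linear on each half of the circle, so each half gives one `halfWave`; their common
phase factor has modulus 1. -/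
theorem norm_fourierCoeff_oddGraph (t : ℝ) (m : ℤ) :
    ‖fourierCoeff (propagator oddGraph.symbol t) m‖ = tents (Real.pi * t / 2) m := by
  have hcoe : Continuous fun y : ℝ => (y : UnitAddCircle) := AddCircle.continuous_mk' 1
  have hc : Continuous fun x : ℝ => fourier (T := (1 : ℝ)) (-m) (x : UnitAddCircle) *
      propagator oddGraph.symbol t (x : UnitAddCircle) :=
    ((fourier (T := (1 : ℝ)) (-m)).continuous.comp hcoe).mul
      ((propagator oddGraph.symbol t).continuous.comp hcoe)
  have h1 : ∫ x in (0 : ℝ)..1 / 2, fourier (T := (1 : ℝ)) (-m) (x : UnitAddCircle) *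
      propagator oddGraph.symbol t (x : UnitAddCircle) =
      Complex.exp (-(Complex.I * t) * (Real.pi ^ 2 / 4)) *
        halfWave (2 * Real.pi * (Real.pi * t / 2 - m)) := by
    rw [halfWave, ← intervalIntegral.integral_const_mul]
    refine intervalIntegral.integral_congr fun x hx => ?_
    rw [Set.uIcc_of_le (by norm_num)] at hx
    simp only [propagator_apply]
    rw [fourier_coe_apply, symbol_oddGraph_left hx, ← Complex.exp_add, ← Complex.exp_add]
    congr 1
    push_cast
    ring
  have h2 : ∫ x in (1 / 2 : ℝ)..1, fourier (T := (1 : ℝ)) (-m) (x : UnitAddCircle) *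
      propagator oddGraph.symbol t (x : UnitAddCircle) =
      Complex.exp (-(Complex.I * t) * (Real.pi ^ 2 / 4)) *
        halfWave (2 * Real.pi * (Real.pi * t / 2 + m)) := by
    have := intervalIntegral.integral_comp_sub_left (a := (0 : ℝ)) (b := 1 / 2)
      (fun x : ℝ => fourier (T := (1 : ℝ)) (-m) (x : UnitAddCircle) *
      propagator oddGraph.symbol t (x : UnitAddCircle)) 1
    rw [show (1 : ℝ) - 1 / 2 = 1 / 2 by norm_num, sub_zero] at this
    rw [← this, halfWave, ← intervalIntegral.integral_const_mul]
    refine intervalIntegral.integral_congr fun x hx => ?_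
    rw [Set.uIcc_of_le (by norm_num)] at hx
    simp only [propagator_apply]
    rw [fourier_coe_apply, symbol_oddGraph_right ⟨by linarith [hx.2], by linarith [hx.1]⟩,
      ← Complex.exp_add, ← Complex.exp_add, Complex.exp_eq_exp_iff_exists_int]
    -- The reflection x ↦ 1 - x only leaves a factor e^{-2πim} = 1.
    refine ⟨-m, ?_⟩
    push_cast
    ring
  rw [fourierCoeff_eq_integral_unit, ← intervalIntegral.integral_add_adjacent_intervals
    (hc.intervalIntegrable 0 (1 / 2)) (hc.intervalIntegrable (1 / 2) 1), h1, h2, ← mul_add,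
    norm_mul, tents, Complex.norm_exp]
  simp [← Complex.ofReal_pow]

theorem norm_evolution_oddGraph (t : ℝ) (n m : ℤ) :
    ‖evolution oddGraph.adjacency t (pointMass n) (n + m)‖ = tents (Real.pi * t / 2) m := by
  rw [evolution_pointMass_apply, norm_fourierCoeff_oddGraph, add_sub_cancel_left]

/-- The angles π(s ± m) differ by 2πm, so both waves have the same numerator, of modulus 2|sin(π(s -
m)/2)|. The denominators combine through 1/(s - m) + 1/(s + m) = 2s/(s² - m²). -/
theorem tents_eq {s : ℝ} {m : ℤ} (h : |(m : ℝ)| ≠ |s|) :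
    tents s m = |2 * Real.sin (Real.pi * (s - m) / 2)| / (2 * Real.pi) *
      (2 * |s| / |s ^ 2 - (m : ℝ) ^ 2|) := by
  have hpi := Real.pi_pos
  have h0 : s ^ 2 - (m : ℝ) ^ 2 ≠ 0 := fun h0 => h (sq_eq_sq_iff_abs_eq_abs _ _ |>.1 (by linarith))
  have h1 : s - m ≠ 0 := fun h1 => h0 (by linear_combination (s + m) * h1)
  have h2 : s + m ≠ 0 := fun h1 => h0 (by linear_combination (s - m) * h1)
  have e : Complex.exp (Complex.I * (2 * Real.pi * (s + m) / 2 : ℝ)) =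
      Complex.exp (Complex.I * (Real.pi * (s - m) : ℝ)) := by
    rw [Complex.exp_eq_exp_iff_exists_int]
    refine ⟨m, ?_⟩
    push_cast
    ring
  have hpi' : (Real.pi : ℂ) ≠ 0 := Complex.ofReal_ne_zero.2 hpi.ne'
  have h1' : (s : ℂ) - m ≠ 0 := by exact_mod_cast h1
  have h2' : (s : ℂ) + m ≠ 0 := by exact_mod_cast h2
  have h0' : (s : ℂ) ^ 2 - (m : ℂ) ^ 2 ≠ 0 := by exact_mod_cast h0
  have key : halfWave (2 * Real.pi * (s - m)) + halfWave (2 * Real.pi * (s + m)) =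
      (Complex.exp (Complex.I * (Real.pi * (s - m) : ℝ)) - 1) / (Complex.I * (2 * Real.pi : ℝ)) *
        (2 * s / (s ^ 2 - m ^ 2 : ℝ) : ℂ) := by
    rw [halfWave_eq (by positivity), halfWave_eq (by positivity), e,
      show 2 * Real.pi * (s - m) / 2 = Real.pi * (s - m) by ring]
    push_cast
    field_simp
    ring
  have hc : ∀ r : ℝ, ‖(r : ℂ)‖ = |r| := fun r => by rw [Complex.norm_real, Real.norm_eq_abs]
  rw [tents, key, norm_mul, norm_div, norm_div, Complex.norm_exp_I_mul_ofReal_sub_one,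
    norm_mul Complex.I, norm_mul (2 : ℂ), hc, hc, hc, Complex.norm_I, one_mul, Complex.norm_ofNat,
    abs_of_pos (show 0 < 2 * Real.pi by positivity), Real.norm_eq_abs]

theorem tents_le {s : ℝ} {m : ℤ} (hs : 0 ≤ s) (h : |(m : ℝ)| ≠ s) :
    tents s m ≤ 2 / Real.pi * (s / |s ^ 2 - (m : ℝ) ^ 2|) := by
  have hpi := Real.pi_pos
  rw [tents_eq (by rwa [abs_of_nonneg hs]), abs_of_nonneg hs, abs_mul, abs_two]
  calc 2 * |Real.sin (Real.pi * (s - m) / 2)| / (2 * Real.pi) * (2 * s / |s ^ 2 - (m : ℝ) ^ 2|)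
      ≤ 2 * 1 / (2 * Real.pi) * (2 * s / |s ^ 2 - (m : ℝ) ^ 2|) := by
        gcongr; exact Real.abs_sin_le_one _
    _ = _ := by field_simp

/-- One wave is resonant and gives 1/2; the other runs through whole periods and integrates to 0. At
k = 0 both would be resonant. -/
theorem tents_self {k : ℤ} (hk : k ≠ 0) : tents k k = 1 / 2 := by
  have hpi := Real.pi_pos
  have hk' : (k : ℝ) ≠ 0 := Int.cast_ne_zero.2 hk
  rw [tents, sub_self, mul_zero, halfWave_zero,
    halfWave_eq (mul_ne_zero (by positivity) (by simpa [← two_mul] using hk'))]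
  have e : Complex.exp (Complex.I * (2 * Real.pi * (k + k) / 2 : ℝ)) = 1 := by
    rw [Complex.exp_eq_one_iff]
    exact ⟨k, by push_cast; ring⟩
  rw [e]
  simp

/-- At integers the value is 1 or 1/2. Otherwise, with m = ⌊s⌋, concavity gives sin(πu/2) > u for u
= s - m in (0, 1), which cancels the factor s - m and leaves 2s/(π(s + m)) ≥ 1/π. -/
theorem one_div_pi_lt_tents_floor {s : ℝ} (hs : 0 ≤ s) : 1 / Real.pi < tents s ⌊s⌋ := by
  have hpi := Real.pi_pos
  have h3 := Real.pi_gt_three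
  have hpi2 : 1 / Real.pi < 1 / 2 := by
    rw [div_lt_div_iff₀ hpi two_pos]; linarith
  have hfl := Int.floor_le s
  have hfl2 := Int.lt_floor_add_one s
  have hm : (0 : ℝ) ≤ ⌊s⌋ := Int.cast_nonneg (Int.floor_nonneg.2 hs)
  rcases eq_or_lt_of_le hfl with h | h
  · rw [← h, Int.floor_intCast]
    by_cases h0 : ⌊s⌋ = 0
    · rw [h0, tents]
      simp only [Int.cast_zero, sub_zero, add_zero, mul_zero, halfWave_zero]
      norm_num
      rw [← one_div]; linarith
    · rwa [tents_self h0]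
  · set m : ℝ := (⌊s⌋ : ℝ) with hmdef
    have hsin : s - m < Real.sin (Real.pi * (s - m) / 2) := by
      have := Real.mul_lt_sin (x := Real.pi * (s - m) / 2)
        (by have := sub_pos.2 h; positivity) (by nlinarith)
      refine lt_of_eq_of_lt ?_ this
      field_simp
    have hsm : 0 < s - m := sub_pos.2 h
    have hs0 : 0 < s := by linarith
    rw [tents_eq (by rw [abs_of_nonneg hm, abs_of_nonneg hs]; exact h.ne), abs_of_nonneg hs,
      abs_of_pos (by linarith), ← hmdef, abs_of_pos (by nlinarith : 0 < s ^ 2 - m ^ 2)]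
    calc 1 / Real.pi ≤ 2 * (s - m) / (2 * Real.pi) * (2 * s / (s ^ 2 - m ^ 2)) := by
          rw [show s ^ 2 - m ^ 2 = (s - m) * (s + m) by ring]
          have : 2 * (s - m) / (2 * Real.pi) * (2 * s / ((s - m) * (s + m))) =
            1 / Real.pi * (2 * s / (s + m)) := by field_simp
          rw [this]
          refine le_mul_of_one_le_right (by positivity) ?_
          rw [one_le_div (by linarith)]
          linarith
      _ < _ := by
          have : 0 < 2 * s / (s ^ 2 - m ^ 2) := div_pos (by linarith) (by nlinarith)
          gcongr

/-- Distinct integers |m| and k satisfy |k² - m²| ≥ 2k - 1, and 4k < π(2k - 1) for k ≥ 2. This bound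
fails at k = 1. -/
theorem tents_lt_half {k m : ℤ} (hk : 2 ≤ k) (hm : |m| ≠ k) : tents k m < 1 / 2 := by
  have hpi := Real.pi_gt_d2
  have hk' : (2 : ℝ) ≤ k := by exact_mod_cast hk
  have hgap : 2 * (k : ℝ) - 1 ≤ |(k : ℝ) ^ 2 - (m : ℝ) ^ 2| := by
    have hmc : (m : ℝ) ^ 2 = ((|m| : ℤ) : ℝ) ^ 2 := by rw [Int.cast_abs, sq_abs]
    have h0 : (0 : ℝ) ≤ ((|m| : ℤ) : ℝ) := by exact_mod_cast abs_nonneg m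
    rw [hmc]
    rcases lt_or_gt_of_ne hm with h | h
    · have h1 : ((|m| : ℤ) : ℝ) ≤ k - 1 := by exact_mod_cast Int.le_sub_one_of_lt h
      exact le_trans (by nlinarith) (le_abs_self _)
    · have h1 : (k : ℝ) + 1 ≤ ((|m| : ℤ) : ℝ) := by exact_mod_cast h
      exact le_trans (by nlinarith) (neg_le_abs _)
  refine (tents_le (by linarith) (by exact_mod_cast hm)).trans_lt ?_
  have h1 : (0 : ℝ) < 2 * k - 1 := by linarith
  calc 2 / Real.pi * (k / |(k : ℝ) ^ 2 - (m : ℝ) ^ 2|) ≤ 2 / Real.pi * (k / (2 * k - 1)) := by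
        gcongr
    _ < 1 / 2 := by
        rw [div_mul_div_comm, div_lt_div_iff₀ (by positivity) two_pos]
        nlinarith

theorem one_div_pi_lt_supNorm_oddGraph (n : ℤ) (t : ℝ) :
    1 / Real.pi < supNorm (evolution oddGraph.adjacency t (pointMass n)) := by
  -- The profile is even in s, so |s| covers negative times too.
  have h := one_div_pi_lt_tents_floor (abs_nonneg (Real.pi * t / 2))
  refine h.trans_le (le_trans (le_of_eq ?_)
    (norm_apply_le_supNorm _ (n + ⌊|Real.pi * t / 2|⌋)))
  rw [norm_evolution_oddGraph]
  rcases abs_choice (Real.pi * t / 2) with h | h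
  · rw [h]
  · rw [h, tents_neg_left]

theorem not_disperses_oddGraph {α : ℝ} (hα : 0 < α) : ¬ Disperses oddGraph.adjacency α :=
  not_disperses_of_le (by positivity) (fun t _ => (one_div_pi_lt_supNorm_oddGraph 0 t).le) hα

theorem norm_evolution_oddGraph_sub (t : ℝ) (n m : ℤ) :
    ‖evolution oddGraph.adjacency t (pointMass n) (n - m)‖ = tents (Real.pi * t / 2) m := by
  rw [sub_eq_add_neg, norm_evolution_oddGraph, tents_neg_right]

theorem two_tents :
    (∀ (n : ℤ) (t : ℝ), 0 ≤ t →
      1 / Real.pi <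
        ‖evolution oddGraph.adjacency t (pointMass n) (n + ⌊Real.pi * t / 2⌋)‖ ∧
      1 / Real.pi <
        ‖evolution oddGraph.adjacency t (pointMass n) (n - ⌊Real.pi * t / 2⌋)‖) ∧
    (∀ n k : ℤ, 1 ≤ k →
      ‖evolution oddGraph.adjacency (2 * k / Real.pi) (pointMass n) (n + k)‖ = 1 / 2 ∧
      ‖evolution oddGraph.adjacency (2 * k / Real.pi) (pointMass n) (n - k)‖ = 1 / 2) ∧
    (∀ n k m : ℤ, 2 ≤ k → |m| ≠ k →
      ‖evolution oddGraph.adjacency (2 * k / Real.pi) (pointMass n) (n + m)‖ < 1 / 2) ∧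
    (∀ (n m : ℤ) (t : ℝ), 0 ≤ t → |(m : ℝ)| ≠ Real.pi * t / 2 →
      ‖evolution oddGraph.adjacency t (pointMass n) (n + m)‖ ≤
        2 / Real.pi * ((Real.pi * t / 2) / |(Real.pi * t / 2) ^ 2 - (m : ℝ) ^ 2|)) := by
  have hpi := Real.pi_pos
  have hs : ∀ k : ℤ, Real.pi * (2 * k / Real.pi) / 2 = k := fun k => by field_simp
  simp only [norm_evolution_oddGraph, norm_evolution_oddGraph_sub, hs, and_self]
  exact ⟨fun _ t ht => one_div_pi_lt_tents_floor (by positivity),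
    fun _ k hk => tents_self (by omega), fun _ k m hk hm => tents_lt_half hk hm,
    fun _ m t ht hm => tents_le (by positivity) hm⟩

/-! ### The full graph: dispersion by Fresnel integrals -/

theorem disperses_of_norm_fourierCoeff_le {Γ : PeriodicGraph} {C α : ℝ}
    (h : ∀ t : ℝ, 0 < t → ∀ n : ℤ, ‖fourierCoeff (propagator Γ.symbol t) n‖ ≤ C * t ^ (-α)) :
    Disperses Γ.adjacency α := by
  refine ⟨C, fun t ht ψ hψ => ciSup_le fun n => ?_⟩
  rw [← Γ.contMultiplier_symbol, evolution_contMultiplier]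
  refine (hasSum_contMultiplier _ ψ n).norm_le_of_bounded (hψ.hasSum.mul_left _) fun j => ?_
  rw [norm_mul, mul_comm]
  exact mul_le_mul_of_nonneg_right (h t ht _) (norm_nonneg _)

theorem norm_exp_neg_I_mul (r : ℝ) : ‖Complex.exp (-(Complex.I * r))‖ = 1 := by
  rw [Complex.norm_exp]
  simp

/-- Integrate by parts with i e^{-iy²}/(2y). The boundary terms are at most 1/2 + 1/(2d), the
remainder at most 1/2 - 1/(2d). -/
theorem norm_fresnel_one_le {d : ℝ} (hd : 1 ≤ d) :
    ‖∫ y in (1 : ℝ)..d, Complex.exp (-(Complex.I * (y ^ 2 : ℝ)))‖ ≤ 1 := by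
  set e : ℝ → ℂ := fun y => Complex.exp (-(Complex.I * (y ^ 2 : ℝ))) with he
  have hne : ∀ y, ‖e y‖ = 1 := fun y => norm_exp_neg_I_mul _
  have hec : Continuous e := by fun_prop
  have hpos : ∀ y ∈ Set.uIcc 1 d, 0 < y := fun y hy => by
    rw [Set.uIcc_of_le hd] at hy
    linarith [hy.1]
  have hq : ContinuousOn (fun y : ℝ => 1 / (2 * y ^ 2)) (Set.uIcc 1 d) :=
    continuousOn_const.div (by fun_prop) fun y hy => by have := hpos y hy; positivity
  have hi1 : IntervalIntegrable (fun y : ℝ => 1 / (2 * y ^ 2)) volume 1 d :=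
    hq.intervalIntegrable
  have hi2 : IntervalIntegrable (fun y : ℝ => ((1 / (2 * y ^ 2) : ℝ) : ℂ) * (Complex.I * e y))
      volume 1 d :=
    ((Complex.continuous_ofReal.comp_continuousOn hq).mul
      (continuous_const.mul hec).continuousOn).intervalIntegrable
  have h1 : ∫ y in (1 : ℝ)..d, (e y - ((1 / (2 * y ^ 2) : ℝ) : ℂ) * (Complex.I * e y)) =
      Complex.I / (2 * d) * e d - Complex.I / (2 * (1 : ℝ)) * e 1 := by
    refine intervalIntegral.integral_eq_sub_of_hasDerivAt
      (f := fun y : ℝ => Complex.I / (2 * y) * e y) (fun y hy => ?_)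
      ((hec.intervalIntegrable _ _).sub hi2)
    have hy0 : (y : ℂ) ≠ 0 := Complex.ofReal_ne_zero.2 (hpos y hy).ne'
    have hof : HasDerivAt (fun y : ℝ => (y : ℂ)) 1 y := Complex.ofRealCLM.hasDerivAt
    have d1 : HasDerivAt (fun y : ℝ => Complex.I / (2 * (y : ℂ)))
        (-(Complex.I * 2) / (2 * y) ^ 2) y := by
      refine ((hasDerivAt_const y Complex.I).div (hof.const_mul 2)
        (mul_ne_zero two_ne_zero hy0)).congr_deriv ?_
      ring
    have d2 : HasDerivAt e (e y * -(Complex.I * (2 * y))) y := by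
      have : HasDerivAt (fun y : ℝ => ((y ^ 2 : ℝ) : ℂ)) (2 * y) y := by
        simpa using (hasDerivAt_pow 2 y).ofReal_comp
      exact (this.const_mul Complex.I).neg.cexp
    refine (d1.mul d2).congr_deriv ?_
    push_cast
    field_simp
    linear_combination (-2 * (y : ℂ) ^ 2 * e y) * Complex.I_sq
  have h2 : ∫ y in (1 : ℝ)..d, 1 / (2 * y ^ 2) = -1 / (2 * d) - -1 / (2 * 1) := by
    refine intervalIntegral.integral_eq_sub_of_hasDerivAt
      (f := fun y : ℝ => -1 / (2 * y)) (fun y hy => ?_) hi1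
    have hy0 := (hpos y hy).ne'
    refine ((hasDerivAt_const y (-1 : ℝ)).div ((hasDerivAt_id y).const_mul 2)
      (mul_ne_zero two_ne_zero hy0)).congr_deriv ?_
    simp only [id]
    field_simp
    ring
  have h3 : ‖∫ y in (1 : ℝ)..d, ((1 / (2 * y ^ 2) : ℝ) : ℂ) * (Complex.I * e y)‖ ≤
      -1 / (2 * d) - -1 / (2 * 1) := by
    rw [← h2]
    refine intervalIntegral.norm_integral_le_of_norm_le hd (ae_of_all _ fun y hy => ?_) hi1
    rw [norm_mul, norm_mul, hne, Complex.norm_I, Complex.norm_real,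
      Real.norm_of_nonneg (by positivity)]
    simp
  rw [intervalIntegral.integral_sub (hec.intervalIntegrable _ _) hi2, sub_eq_iff_eq_add] at h1
  rw [h1]
  have hd0 : 0 < d := by linarith
  have n1 : ‖Complex.I / (2 * d) * e d‖ = 1 / (2 * d) := by
    rw [norm_mul, hne, mul_one, norm_div, norm_mul, Complex.norm_I, Complex.norm_real,
      Real.norm_of_nonneg hd0.le, Complex.norm_ofNat]
  have n2 : ‖Complex.I / (2 * (1 : ℝ)) * e 1‖ = 1 / 2 := by
    rw [norm_mul, hne, mul_one, norm_div, norm_mul, Complex.norm_I, Complex.norm_real,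
      Complex.norm_ofNat]
    simp
  refine (norm_add_le_of_le (norm_sub_le_of_le n1.le n2.le) h3).trans (le_of_eq ?_)
  ring

theorem norm_fresnel_le (d : ℝ) :
    ‖∫ y in (0 : ℝ)..d, Complex.exp (-(Complex.I * (y ^ 2 : ℝ)))‖ ≤ 2 := by
  have hc : Continuous fun y : ℝ => Complex.exp (-(Complex.I * (y ^ 2 : ℝ))) := by fun_prop
  have hsmall : ∀ d : ℝ, 0 ≤ d → d ≤ 1 →
      ‖∫ y in (0 : ℝ)..d, Complex.exp (-(Complex.I * (y ^ 2 : ℝ)))‖ ≤ 1 := fun d h0 h1 => by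
    refine (intervalIntegral.norm_integral_le_of_norm_le_const
      fun y _ => (norm_exp_neg_I_mul _).le).trans ?_
    rwa [sub_zero, one_mul, abs_of_nonneg h0]
  have hnonneg : ∀ d : ℝ, 0 ≤ d →
      ‖∫ y in (0 : ℝ)..d, Complex.exp (-(Complex.I * (y ^ 2 : ℝ)))‖ ≤ 2 := fun d h0 => by
    rcases le_total d 1 with h1 | h1
    · linarith [hsmall d h0 h1]
    · rw [← intervalIntegral.integral_add_adjacent_intervals (hc.intervalIntegrable 0 1)
        (hc.intervalIntegrable 1 d)]
      refine (norm_add_le_of_le (hsmall 1 zero_le_one le_rfl) (norm_fresnel_one_le h1)).trans ?_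
      norm_num
  rcases le_total 0 d with h | h
  · exact hnonneg d h
  · have h1 := intervalIntegral.integral_comp_neg (a := 0) (b := d)
      (fun y : ℝ => Complex.exp (-(Complex.I * (y ^ 2 : ℝ))))
    simp only [neg_sq, neg_zero] at h1
    rw [h1, intervalIntegral.integral_symm, norm_neg]
    exact hnonneg _ (by linarith)

/-- Completing the square and rescaling by √a gives a difference of two Fresnel integrals. The bound
does not depend on b, which carries the position n in the application. -/
theorem norm_integral_exp_quadratic_le {a : ℝ} (ha : 0 < a) (b c : ℝ) :
    ‖∫ x in (0 : ℝ)..1, Complex.exp (-(Complex.I * (a * x ^ 2 + b * x + c : ℝ)))‖ ≤ 4 / √a := by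
  have hs : 0 < √a := Real.sqrt_pos.2 ha
  have hs2 : √a ^ 2 = a := Real.sq_sqrt ha.le
  have hc : Continuous fun y : ℝ => Complex.exp (-(Complex.I * (y ^ 2 : ℝ))) := by fun_prop
  have h1 : ∀ x : ℝ, Complex.exp (-(Complex.I * (a * x ^ 2 + b * x + c : ℝ))) =
      Complex.exp (-(Complex.I * (c - (b / (2 * √a)) ^ 2 : ℝ))) *
        Complex.exp (-(Complex.I * ((√a * x + b / (2 * √a)) ^ 2 : ℝ))) := fun x => by
    rw [← Complex.exp_add, ← neg_add, ← mul_add, ← Complex.ofReal_add]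
    congr 4
    rw [add_sq, mul_pow, hs2]
    field_simp
    ring
  simp only [h1]
  rw [intervalIntegral.integral_const_mul, norm_mul, norm_exp_neg_I_mul, one_mul,
    intervalIntegral.integral_comp_mul_add
      (fun y : ℝ => Complex.exp (-(Complex.I * (y ^ 2 : ℝ)))) hs.ne',
    ← intervalIntegral.integral_interval_sub_left (hc.intervalIntegrable 0 _)
      (hc.intervalIntegrable 0 _), norm_smul, norm_inv, Real.norm_of_nonneg hs.le,
    inv_mul_eq_div]
  gcongr
  refine (norm_sub_le_of_le (norm_fresnel_le _) (norm_fresnel_le _)).trans ?_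
  norm_num

theorem disperses_fullGraph : Disperses fullGraph.adjacency (1 / 2) := by
  refine disperses_of_norm_fourierCoeff_le (C := 4 / √(2 * Real.pi ^ 2)) fun t ht n => ?_
  have h := norm_integral_exp_quadratic_le (a := 2 * Real.pi ^ 2 * t) (by positivity)
    (2 * Real.pi * n - 2 * Real.pi ^ 2 * t) (2 * Real.pi ^ 2 * t / 6)
  refine (le_of_eq ?_).trans (h.trans (le_of_eq ?_))
  · rw [fourierCoeff_eq_integral_unit]
    congr 1
    refine intervalIntegral.integral_congr fun x hx => ?_
    rw [Set.uIcc_of_le zero_le_one] at hx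
    simp only [propagator_apply]
    rw [fourier_coe_apply, symbol_fullGraph hx, ← Complex.exp_add]
    congr 1
    push_cast
    ring
  · rw [Real.sqrt_mul (by positivity), Real.rpow_neg ht.le, ← Real.sqrt_eq_rpow]
    field_simp

/-! ### The lattice: the wave front decays more slowly than t^{-1/2} -/

/-- A one-sided van der Corput estimate for the phase φ = m(x - sin x). The derivative of (sin φ +
1)/φ' is cos φ - (sin φ + 1)φ''/φ'², which is at most cos φ because φ'' ≥ 0; the added 1 fixes the
sign. -/
theorem neg_div_le_integral_cos_mul {m a : ℝ} (hm : 0 < m) (ha : 0 < a) (haπ : a ≤ Real.pi) :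
    -(2 / (m * (1 - Real.cos a))) ≤
      ∫ x in a..Real.pi, Real.cos (m * (x - Real.sin x)) := by
  have hpos : ∀ x ∈ Set.Icc a Real.pi, 0 < 1 - Real.cos x := fun x hx => by
    have := Real.cos_lt_cos_of_nonneg_of_le_pi le_rfl hx.2 (ha.trans_le hx.1)
    rw [Real.cos_zero] at this
    linarith
  have hsin : ∀ x : ℝ, 0 ≤ Real.sin x + 1 := fun x => by linarith [Real.neg_one_le_sin x]
  have key := intervalIntegral.sub_le_integral_of_hasDeriv_right_of_le haπ
    (g := fun x => (Real.sin (m * (x - Real.sin x)) + 1) / (m * (1 - Real.cos x)))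
    (g' := fun x => (Real.cos (m * (x - Real.sin x)) * (m * (1 - Real.cos x)) *
      (m * (1 - Real.cos x)) - (Real.sin (m * (x - Real.sin x)) + 1) * (m * Real.sin x)) /
      (m * (1 - Real.cos x)) ^ 2)
    (φ := fun x => Real.cos (m * (x - Real.sin x)))
    (ContinuousOn.div (by fun_prop) (by fun_prop)
      fun x hx => (mul_pos hm (hpos x hx)).ne')
    (fun x hx => by
      have h0 := (mul_pos hm (hpos x ⟨hx.1.le, hx.2.le⟩)).ne'
      have h1 : HasDerivAt (fun x => Real.sin (m * (x - Real.sin x)) + 1)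
          (Real.cos (m * (x - Real.sin x)) * (m * (1 - Real.cos x))) x :=
        ((((hasDerivAt_id x).sub (Real.hasDerivAt_sin x)).const_mul m).sin).add_const 1
      have h2 : HasDerivAt (fun x => m * (1 - Real.cos x)) (m * Real.sin x) x :=
        (((Real.hasDerivAt_cos x).const_sub 1).const_mul m).congr_deriv (by ring)
      exact (h1.div h2 h0).hasDerivWithinAt)
    ((by fun_prop : Continuous fun x => Real.cos (m * (x - Real.sin x))).integrableOn_Icc)
    (fun x hx => by
      have h0 := mul_pos hm (hpos x ⟨hx.1.le, hx.2.le⟩)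
      rw [div_le_iff₀ (by positivity)]
      have := mul_nonneg (hsin (m * (x - Real.sin x))) (mul_nonneg hm.le
        (Real.sin_nonneg_of_nonneg_of_le_pi (ha.le.trans hx.1.le) hx.2.le))
      nlinarith)
  refine le_trans ?_ key
  have h1 : 0 ≤ (Real.sin (m * (Real.pi - Real.sin Real.pi)) + 1) /
      (m * (1 - Real.cos Real.pi)) :=
    div_nonneg (hsin _) (mul_pos hm (hpos _ ⟨haπ, le_rfl⟩)).le
  have h2 : (Real.sin (m * (a - Real.sin a)) + 1) / (m * (1 - Real.cos a)) ≤
      2 / (m * (1 - Real.cos a)) := by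
    have := mul_pos hm (hpos a ⟨le_rfl, haπ⟩)
    gcongr
    linarith [Real.sin_le_one (m * (a - Real.sin a))]
  linarith

/-- The phase is cubic at 0. On [0, 1/N] it is at most 2N³x³, so cos ≥ 1 - 2N⁶x⁶ contributes at
least (1 - 2/7)/N. The van der Corput bound costs at most (24/43)/N on the rest, and 5/7 - 24/43 >
1/7. -/
theorem div_le_integral_cos_mul_sub_sin {N : ℝ} (hN : 1 ≤ N) :
    1 / 7 / N ≤ ∫ x in (0 : ℝ)..Real.pi, Real.cos (8 * N ^ 3 * (x - Real.sin x)) := by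
  have hN0 : 0 < N := by linarith
  have ha0 : 0 < 1 / N := by positivity
  have ha1 : 1 / N ≤ 1 := by rw [div_le_one hN0]; exact hN
  have hc : Continuous fun x => Real.cos (8 * N ^ 3 * (x - Real.sin x)) := by fun_prop
  have h1 : 5 / 7 / N ≤ ∫ x in (0 : ℝ)..1 / N, Real.cos (8 * N ^ 3 * (x - Real.sin x)) := by
    have h2 : ∫ x in (0 : ℝ)..1 / N, (1 - 2 * N ^ 6 * x ^ 6) = 5 / 7 / N := by
      rw [intervalIntegral.integral_sub (by simp) ((by fun_prop : Continuous fun x : ℝ =>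
        2 * N ^ 6 * x ^ 6).intervalIntegrable _ _), intervalIntegral.integral_const_mul,
        integral_pow, intervalIntegral.integral_const]
      simp
      field_simp
      norm_num
    rw [← h2]
    refine intervalIntegral.integral_mono_on ha0.le
      ((by fun_prop : Continuous fun x : ℝ => 1 - 2 * N ^ 6 * x ^ 6).intervalIntegrable _ _)
      (hc.intervalIntegrable _ _) fun x hx => ?_
    have hF0 : 0 ≤ x - Real.sin x := sub_nonneg.2 (Real.sin_le hx.1)
    have hF : x - Real.sin x ≤ x ^ 3 / 4 := by
      rcases hx.1.eq_or_lt with h | h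
      · simp [← h]
      · linarith [Real.sin_gt_sub_cube h, pow_pos h 3]
    have hsq : (8 * N ^ 3 * (x - Real.sin x)) ^ 2 ≤ (8 * N ^ 3 * (x ^ 3 / 4)) ^ 2 := by
      gcongr
    refine le_trans ?_ (Real.one_sub_sq_div_two_le_cos)
    nlinarith
  have h2 := neg_div_le_integral_cos_mul (m := 8 * N ^ 3) (a := 1 / N) (by positivity) ha0
    (ha1.trans (by linarith [Real.pi_gt_three]))
  -- 43/96 = 1/2 - 5/96, where 5/96 is the constant of the quartic error in `Real.cos_bound`.
  have hcos : 43 / 96 * (1 / N) ^ 2 ≤ 1 - Real.cos (1 / N) := by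
    have h3 := (abs_le.1 (Real.cos_bound (x := 1 / N) (by rwa [abs_of_pos ha0]))).2
    rw [abs_of_pos ha0] at h3
    have : (1 / N) ^ 4 ≤ (1 / N) ^ 2 := pow_le_pow_of_le_one ha0.le ha1 (by norm_num)
    linarith
  have h3 : 2 / (8 * N ^ 3 * (1 - Real.cos (1 / N))) ≤ 24 / 43 / N := by
    calc 2 / (8 * N ^ 3 * (1 - Real.cos (1 / N))) ≤ 2 / (8 * N ^ 3 * (43 / 96 * (1 / N) ^ 2)) := by
          gcongr
      _ = _ := by field_simp; norm_num
  rw [← intervalIntegral.integral_add_adjacent_intervals (hc.intervalIntegrable 0 (1 / N))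
    (hc.intervalIntegrable (1 / N) Real.pi)]
  have h4 : 1 / 7 / N ≤ 5 / 7 / N - 24 / 43 / N := by
    rw [← sub_div]
    gcongr
    norm_num
  linarith

theorem symbol_latticeGraph (x : ℝ) :
    latticeGraph.symbol (x : UnitAddCircle) = ((2 * Real.cos (2 * Real.pi * x) : ℝ) : ℂ) := by
  have h := hasSum_sum_of_ne_finset_zero (L := SummationFilter.unconditional ℤ) (s := ({1, -1} : Finset ℤ))
    (f := fun k : ℤ => (latticeGraph.w k : ℂ) * fourier k (x : UnitAddCircle)) fun k hk => by
      have : latticeGraph.w k = 0 := if_neg (by simpa using hk)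
      rw [this, Complex.ofReal_zero, zero_mul]
  rw [(latticeGraph.hasSum_symbol x).unique h, Finset.sum_pair (by norm_num),
    show latticeGraph.w 1 = 1 by simp [latticeGraph],
    show latticeGraph.w (-1) = 1 by simp [latticeGraph], fourier_coe_apply, fourier_coe_apply]
  push_cast
  rw [Complex.two_cos]
  congr 2 <;> ring_nf

/-- The maximal group velocity is 2, so at time m/2 the site m lies on the wave front. The left side
is the integral for the Bessel value J_m(m). -/
theorem le_norm_fourierCoeff_latticeGraph (m : ℤ) :
    (∫ x in (0 : ℝ)..Real.pi, Real.cos (m * (x - Real.sin x))) / Real.pi ≤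
      ‖fourierCoeff (propagator latticeGraph.symbol (m / 2)) m‖ := by
  have hpi := Real.pi_pos
  set G : ℝ → ℂ := fun y => Complex.exp (-(Complex.I * (m * (y - Real.sin y) : ℝ))) with hG
  have hGc : Continuous G := by fun_prop
  have h1 : fourierCoeff (propagator latticeGraph.symbol (m / 2)) m =
      Complex.exp (-(Complex.I * (m * (Real.pi / 2) : ℝ))) *
        ∫ x in (-1 / 4 : ℝ)..-1 / 4 + 1, G (2 * Real.pi * x + -(Real.pi / 2)) := by
    -- Starting the period at -1/4 makes y = 2πx - π/2 run over [-π, π], with the degenerate point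
    -- at y = 0.
    rw [fourierCoeff_eq_intervalIntegral _ _ (-1 / 4), ← intervalIntegral.integral_const_mul]
    simp only [div_one, one_smul]
    refine intervalIntegral.integral_congr fun x _ => ?_
    simp only [propagator_apply, smul_eq_mul, hG]
    rw [fourier_coe_apply, symbol_latticeGraph, ← Complex.exp_add, ← Complex.exp_add,
      ← sub_eq_add_neg (2 * Real.pi * x), Real.sin_sub_pi_div_two]
    congr 1
    push_cast
    ring
  rw [intervalIntegral.integral_comp_mul_add G (by positivity),
    show 2 * Real.pi * (-1 / 4) + -(Real.pi / 2) = -Real.pi by ring,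
    show 2 * Real.pi * (-1 / 4 + 1) + -(Real.pi / 2) = Real.pi by ring] at h1
  have h2 : (∫ x in (-Real.pi)..Real.pi, G x).re =
      2 * ∫ x in (0 : ℝ)..Real.pi, Real.cos (m * (x - Real.sin x)) := by
    have hre : ∀ x, (G x).re = Real.cos (m * (x - Real.sin x)) := fun x => by
      simp only [hG]
      rw [← mul_neg, ← Complex.ofReal_neg, mul_comm, Complex.exp_ofReal_mul_I_re, Real.cos_neg]
    have hc : Continuous fun x : ℝ => Real.cos (m * (x - Real.sin x)) := by fun_prop
    have h3 := Complex.reCLM.intervalIntegral_comp_comm (μ := volume)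
      (hGc.intervalIntegrable (-Real.pi) Real.pi)
    simp only [Complex.reCLM_apply, hre] at h3
    rw [← h3, ← intervalIntegral.integral_add_adjacent_intervals
      (hc.intervalIntegrable (-Real.pi) 0) (hc.intervalIntegrable 0 Real.pi), two_mul]
    congr 1
    have h4 := intervalIntegral.integral_comp_neg (a := 0) (b := Real.pi)
      (fun x : ℝ => Real.cos (m * (x - Real.sin x)))
    rw [neg_zero] at h4
    rw [← h4]
    refine intervalIntegral.integral_congr fun x _ => ?_
    rw [Real.sin_neg, ← Real.cos_neg]
    congr 1
    ring
  rw [h1, norm_mul, norm_exp_neg_I_mul, one_mul, norm_smul, norm_inv,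
    Real.norm_of_nonneg (by positivity)]
  have h3 := h2 ▸ Complex.re_le_norm (∫ x in (-Real.pi)..Real.pi, G x)
  rw [inv_mul_eq_div, div_le_div_iff₀ hpi (by positivity)]
  nlinarith

theorem not_disperses_latticeGraph : ¬ Disperses latticeGraph.adjacency (1 / 2) := by
  rintro ⟨C, hC⟩
  have hpi := Real.pi_pos
  -- Take m = 8M⁶ and t = 4M⁶, so that both roots are exact: the amplitude is at least 1/(7πM²),
  -- while t^{-1/2} = 1/(2M³).
  have h : ∀ M : ℕ, 1 ≤ M → 2 * (M : ℝ) / (7 * Real.pi) ≤ C := fun M hM => by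
    have hM' : (1 : ℝ) ≤ M := by exact_mod_cast hM
    have hM0 : (0 : ℝ) < M := by linarith
    have ht : (0 : ℝ) < ((8 * M ^ 6 : ℤ) : ℝ) / 2 := by push_cast; positivity
    have h1 := hC _ ht (pointMass 0) (by
      rw [norm_pointMass_apply]
      exact (hasSum_pi_single _ _).summable)
    rw [norm_pointMass_apply, tsum_pi_single, mul_one] at h1
    have h2 := (le_norm_fourierCoeff_latticeGraph (8 * M ^ 6)).trans (le_of_eq_of_le
      (by rw [evolution_pointMass_apply, sub_zero])
      ((norm_apply_le_supNorm _ (8 * (M : ℤ) ^ 6)).trans h1))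
    have h3 := div_le_integral_cos_mul_sub_sin (N := (M : ℝ) ^ 2) (by nlinarith)
    have h4 : ((8 * M ^ 6 : ℤ) : ℝ) = 8 * ((M : ℝ) ^ 2) ^ 3 := by push_cast; ring
    have h5 : (((8 * M ^ 6 : ℤ) : ℝ) / 2) ^ (-(1 / 2) : ℝ) = 1 / (2 * M ^ 3) := by
      rw [show ((8 * M ^ 6 : ℤ) : ℝ) / 2 = (2 * (M : ℝ) ^ 3) ^ 2 by push_cast; ring,
        Real.rpow_neg (by positivity), ← Real.sqrt_eq_rpow, Real.sqrt_sq (by positivity), one_div]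
    rw [h5, h4] at h2
    have h6 := (div_le_div_of_nonneg_right h3 hpi.le).trans h2
    rw [mul_one_div, le_div_iff₀ (by positivity)] at h6
    refine le_trans (le_of_eq ?_) h6
    field_simp
  obtain ⟨M, hM⟩ := exists_nat_gt (max 1 (C * (7 * Real.pi) / 2))
  have h1 := h M (by exact_mod_cast ((le_max_left _ _).trans hM.le))
  rw [div_le_iff₀ (by positivity)] at h1
  have h2 := (le_max_right _ _).trans_lt hM
  linarith

/-! ### The graph modulo 4: plateau and return amplitude -/

theorem symbol_modFourGraph_left {x : ℝ} (hx : x ∈ Set.Icc (0 : ℝ) (1 / 4)) :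
    modFourGraph.symbol (x : UnitAddCircle) =
      ((3 * Real.pi ^ 2 / 8 - 2 * Real.pi ^ 2 * x : ℝ) : ℂ) := by
  rw [symbol_modFourGraph_eq, two_nsmul_coe, symbol_oddGraph_left ⟨hx.1, by linarith [hx.2]⟩,
    symbol_oddGraph_left ⟨by linarith [hx.1], by linarith [hx.2]⟩]
  push_cast
  ring

/-- On each half of this interval the two tents have opposite slopes ±π². -/
theorem symbol_modFourGraph_middle {x : ℝ} (hx : x ∈ Set.Icc (1 / 4 : ℝ) (3 / 4)) :
    modFourGraph.symbol (x : UnitAddCircle) = ((-(Real.pi ^ 2 / 8) : ℝ) : ℂ) := by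
  rw [symbol_modFourGraph_eq]
  rcases le_total x (1 / 2) with h | h
  · rw [two_nsmul_coe, symbol_oddGraph_left ⟨by linarith [hx.1], h⟩,
      symbol_oddGraph_right ⟨by linarith [hx.1], by linarith⟩]
    push_cast
    ring
  · rw [two_nsmul_coe_sub_one, symbol_oddGraph_right ⟨h, by linarith [hx.2]⟩,
      symbol_oddGraph_left ⟨by linarith, by linarith [hx.2]⟩]
    push_cast
    ring

theorem symbol_modFourGraph_right {x : ℝ} (hx : x ∈ Set.Icc (3 / 4 : ℝ) 1) :
    modFourGraph.symbol (x : UnitAddCircle) =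
      ((3 * Real.pi ^ 2 / 8 - 2 * Real.pi ^ 2 * (1 - x) : ℝ) : ℂ) := by
  rw [symbol_modFourGraph_eq, two_nsmul_coe_sub_one, symbol_oddGraph_right ⟨by linarith [hx.1], hx.2⟩,
    symbol_oddGraph_right ⟨by linarith [hx.1], by linarith [hx.2]⟩]
  push_cast
  ring

/-- For 0 < y ≤ π the sine is nonnegative; beyond π > 3 the crude bound -1/y already exceeds -2/5.
-/
theorem neg_two_fifths_le_sinc (y : ℝ) : -(2 / 5) ≤ Real.sinc y := by
  wlog h : 0 ≤ y generalizing y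
  · rw [← Real.sinc_neg]
    exact this (-y) (by linarith)
  have hpi := Real.pi_gt_three
  rcases h.eq_or_lt with h0 | h0
  · rw [← h0, Real.sinc_zero]
    norm_num
  rw [Real.sinc_of_ne_zero h0.ne', le_div_iff₀ h0]
  rcases le_total y Real.pi with h1 | h1
  · have := Real.sin_nonneg_of_nonneg_of_le_pi h h1
    linarith
  · have := Real.neg_one_le_sin y
    linarith

theorem neg_tenth_le_integral_cos (c : ℝ) :
    -(1 / 10) ≤ ∫ x in (0 : ℝ)..1 / 4, Real.cos (c * x) := by
  by_cases hc : c = 0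
  · simp [hc]
    norm_num
  · have h := neg_two_fifths_le_sinc (c * (1 / 4))
    rw [intervalIntegral.integral_comp_mul_left _ hc, integral_cos, mul_zero, Real.sin_zero,
      sub_zero, smul_eq_mul]
    rw [Real.sinc_of_ne_zero (by positivity)] at h
    have h1 : c⁻¹ * Real.sin (c * (1 / 4)) = Real.sin (c * (1 / 4)) / (c * (1 / 4)) / 4 := by
      field_simp
    rw [h1]
    linarith

/-- The plateau has length 1/2. The two sides are mirror images and contribute equally, with phases
measured from the plateau. -/
theorem fourierCoeff_modFourGraph_zero (t : ℝ) :
    fourierCoeff (propagator modFourGraph.symbol t) 0 =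
      Complex.exp (-(Complex.I * (t * -(Real.pi ^ 2 / 8) : ℝ))) *
        (1 / 2 + 2 * ∫ x in (0 : ℝ)..1 / 4,
          Complex.exp (-(Complex.I * (2 * Real.pi ^ 2 * t * x : ℝ)))) := by
  set p : ℝ → ℂ := fun x => propagator modFourGraph.symbol t (x : UnitAddCircle) with hp
  have hc : Continuous p :=
    (propagator modFourGraph.symbol t).continuous.comp (AddCircle.continuous_mk' 1)
  have h1 : ∫ x in (0 : ℝ)..1 / 4, p x =
      Complex.exp (-(Complex.I * (t * -(Real.pi ^ 2 / 8) : ℝ))) * ∫ x in (0 : ℝ)..1 / 4,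
          Complex.exp (-(Complex.I * (2 * Real.pi ^ 2 * t * x : ℝ))) := by
    have := intervalIntegral.integral_comp_sub_left (a := (0 : ℝ)) (b := 1 / 4) p (1 / 4)
    rw [sub_self, sub_zero] at this
    rw [← this, ← intervalIntegral.integral_const_mul]
    refine intervalIntegral.integral_congr fun x hx => ?_
    rw [Set.uIcc_of_le (by norm_num)] at hx
    simp only [hp, propagator_apply]
    rw [symbol_modFourGraph_left ⟨by linarith [hx.2], by linarith [hx.1]⟩, ← Complex.exp_add]
    congr 1
    push_cast
    ring
  have h2 : ∫ x in (1 / 4 : ℝ)..3 / 4, p x =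
      Complex.exp (-(Complex.I * (t * -(Real.pi ^ 2 / 8) : ℝ))) * (1 / 2) := by
    have : ∫ x in (1 / 4 : ℝ)..3 / 4, p x = ∫ x in (1 / 4 : ℝ)..3 / 4,
        Complex.exp (-(Complex.I * (t * -(Real.pi ^ 2 / 8) : ℝ))) := by
      refine intervalIntegral.integral_congr fun x hx => ?_
      rw [Set.uIcc_of_le (by norm_num)] at hx
      simp only [hp, propagator_apply]
      rw [symbol_modFourGraph_middle hx]
      congr 1
      push_cast
      ring
    rw [this, intervalIntegral.integral_const, Complex.real_smul]
    push_cast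
    ring
  have h3 : ∫ x in (3 / 4 : ℝ)..1, p x =
      Complex.exp (-(Complex.I * (t * -(Real.pi ^ 2 / 8) : ℝ))) * ∫ x in (0 : ℝ)..1 / 4,
          Complex.exp (-(Complex.I * (2 * Real.pi ^ 2 * t * x : ℝ))) := by
    have := intervalIntegral.integral_comp_add_left (a := (0 : ℝ)) (b := 1 / 4) p (3 / 4)
    rw [add_zero, show (3 / 4 : ℝ) + 1 / 4 = 1 by norm_num] at this
    rw [← this, ← intervalIntegral.integral_const_mul]
    refine intervalIntegral.integral_congr fun x hx => ?_
    rw [Set.uIcc_of_le (by norm_num)] at hx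
    simp only [hp, propagator_apply]
    rw [symbol_modFourGraph_right ⟨by linarith [hx.1], by linarith [hx.2]⟩, ← Complex.exp_add]
    congr 1
    push_cast
    ring
  rw [fourierCoeff_eq_integral_unit]
  simp only [neg_zero, fourier_zero, one_mul]
  rw [← intervalIntegral.integral_add_adjacent_intervals
    (hc.intervalIntegrable 0 (1 / 4)) (hc.intervalIntegrable (1 / 4) 1),
    ← intervalIntegral.integral_add_adjacent_intervals
    (hc.intervalIntegrable (1 / 4) (3 / 4)) (hc.intervalIntegrable (3 / 4) 1), h1, h2, h3]
  ring

theorem le_norm_evolution_modFourGraph (t : ℝ) :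
    3 / 10 ≤ ‖evolution modFourGraph.adjacency t (pointMass 0) 0‖ := by
  rw [evolution_pointMass_apply, sub_zero, fourierCoeff_modFourGraph_zero, norm_mul,
    norm_exp_neg_I_mul, one_mul]
  refine le_trans ?_ (Complex.re_le_norm _)
  have hre : ∀ x : ℝ, (Complex.exp (-(Complex.I * (2 * Real.pi ^ 2 * t * x : ℝ)))).re =
      Real.cos (2 * Real.pi ^ 2 * t * x) := fun x => by
    rw [← mul_neg, ← Complex.ofReal_neg, mul_comm, Complex.exp_ofReal_mul_I_re, Real.cos_neg]
  have hc : Continuous fun x : ℝ =>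
    Complex.exp (-(Complex.I * (2 * Real.pi ^ 2 * t * x : ℝ))) := by fun_prop
  have h := Complex.reCLM.intervalIntegral_comp_comm (μ := volume)
    (hc.intervalIntegrable 0 (1 / 4))
  simp only [Complex.reCLM_apply, hre] at h
  -- This yields 1/2 - 2 · 1/10 = 3/10.
  have h2 := neg_tenth_le_integral_cos (2 * Real.pi ^ 2 * t)
  rw [h] at h2
  have h3 : ∀ w : ℂ, (1 / 2 + 2 * w).re = 1 / 2 + 2 * w.re := fun w => by
    simp [Complex.add_re, Complex.mul_re]
  rw [h3]
  linarith

theorem not_disperses_modFourGraph {α : ℝ} (hα : 0 < α) : ¬ Disperses modFourGraph.adjacency α :=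
  not_disperses_of_le (by norm_num)
    (fun t _ => (le_norm_evolution_modFourGraph t).trans (norm_apply_le_supNorm _ 0)) hα

/-! ### The flat band -/

theorem mem_eigenspaceOf {A : EllTwo →L[ℂ] EllTwo} {z : ℂ} {ψ : EllTwo} :
    ψ ∈ eigenspaceOf A z ↔ A ψ = z • ψ :=
  Module.End.mem_eigenspace_iff

/-- An eigenvector of the unitary shift would have constant modulus, which is not square summable.
-/
theorem eq_zero_of_translate_eq_smul {φ : EllTwo} {μ : ℂ}
    (h : EllTwo.translate 1 φ = μ • φ) : φ = 0 := by
  by_contra h0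
  have hμ : ‖μ‖ = 1 := by
    have h1 := congrArg norm h
    rw [EllTwo.norm_translate, norm_smul] at h1
    exact (mul_eq_right₀ (norm_ne_zero_iff.2 h0)).1 h1.symm
  have hstep : ∀ n : ℤ, ‖φ (n + 1)‖ = ‖φ n‖ := fun n => by
    have h1 : EllTwo.translate 1 φ n = (μ • φ) n := by rw [h]
    have h2 : φ (n + 1) = μ * φ n := h1
    rw [h2, norm_mul, hμ, one_mul]
  have hconst : ∀ n : ℤ, ‖φ n‖ = ‖φ 0‖ := fun n => by
    induction n using Int.induction_on with
    | zero => rfl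
    | succ k ih => rw [hstep, ih]
    | pred k ih => rw [← hstep, sub_add_cancel, ih]
  have h1 := (hasSum_norm_sq φ).summable
  simp only [hconst] at h1
  have h2 := (summable_const_iff _).1 h1
  refine h0 (lp.ext (funext fun n => ?_))
  have h3 := hconst n
  rw [pow_eq_zero_iff two_ne_zero] at h2
  rw [h2, norm_eq_zero] at h3
  exact h3

/-- Translation commutes with the multiplier and so preserves the eigenspace. In finite dimension it
would have an eigenvector there. -/
theorem not_finiteDimensional_eigenspaceOf {f : C(UnitAddCircle, ℂ)} {z : ℂ}
    {ψ : EllTwo} (hψ : ψ ∈ eigenspaceOf (contMultiplier f) z) (h0 : ψ ≠ 0) :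
    ¬ FiniteDimensional ℂ (eigenspaceOf (contMultiplier f) z) := by
  intro hfin
  have hnt : Nontrivial (eigenspaceOf (contMultiplier f) z) :=
    ⟨⟨⟨ψ, hψ⟩, 0, fun h => h0 (congrArg Subtype.val h)⟩⟩
  have hmaps : ∀ φ ∈ eigenspaceOf (contMultiplier f) z,
      (contMultiplier (fourier (-1)) : EllTwo →ₗ[ℂ] EllTwo) φ ∈
        eigenspaceOf (contMultiplier f) z := fun φ hφ => by
    rw [mem_eigenspaceOf] at hφ ⊢
    change contMultiplier f (contMultiplier (fourier (-1)) φ) =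
      z • contMultiplier (fourier (-1)) φ
    rw [← map_smul, ← hφ, ← mul_apply_eq_comp, ← mul_apply_eq_comp, ← map_mul, ← map_mul, mul_comm]
  obtain ⟨μ, hμ⟩ := Module.End.exists_eigenvalue
    ((contMultiplier (fourier (-1)) : EllTwo →ₗ[ℂ] EllTwo).restrict hmaps)
  obtain ⟨φ, hφ⟩ := hμ.exists_hasEigenvector
  have h1 := congrArg Subtype.val hφ.apply_eq_smul
  refine hφ.2 (Subtype.ext ?_)
  refine eq_zero_of_translate_eq_smul (μ := μ) ?_
  rw [← contMultiplier_fourier]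
  exact h1

/-- The Fourier series of the point mass at 0 is the constant 1, so g vanishes almost everywhere,
hence everywhere by continuity. -/
theorem eq_zero_of_contMultiplier_pointMass {g : C(UnitAddCircle, ℂ)}
    (h : contMultiplier g (pointMass 0) = 0) : g = 0 := by
  have h1 := fourierSeries_multiplier_toLInf g (pointMass 0)
  rw [← contMultiplier_eq, h] at h1
  have h2 : fourierSeries 0 = 0 := map_zero _
  rw [h2] at h1
  have h3 : (fun x => g x) =ᵐ[haarAddCircle (T := (1 : ℝ))] fun _ => 0 := by
    filter_upwards [h1, fourierSeries_pointMass 0, Lp.coeFn_zero ℂ 2 (haarAddCircle (T := (1 : ℝ)))]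
      with x e1 e2 e3
    rw [e2, e3, fourier_zero, mul_one] at e1
    exact e1.symm
  have h4 := (Continuous.ae_eq_iff_eq _ g.continuous continuous_const).1 h3
  ext x
  exact congrFun h4 x

theorem contMultiplier_fourier_pointMass (n : ℤ) :
    contMultiplier (fourier n) (pointMass 0) = pointMass n := by
  ext m
  rw [contMultiplier_pointMass, fourierCoeff_fourier, pointMass, lp.single_apply, sub_zero]

theorem eq_contMultiplier_of_finite_support {ψ : EllTwo} {S : Finset ℤ}
    (hS : ∀ n ∉ S, ψ n = 0) :
    ψ = contMultiplier (∑ n ∈ S, ψ n • fourier n) (pointMass 0) := by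
  have h1 := lp.hasSum_single (p := 2) (by norm_num) ψ
  have h2 : ψ = ∑ n ∈ S, lp.single 2 n (ψ n) :=
    h1.unique (hasSum_sum_of_ne_finset_zero fun n hn => by rw [hS n hn, lp.single_zero])
  nth_rw 1 [h2]
  rw [map_sum, sum_apply]
  refine Finset.sum_congr rfl fun n _ => ?_
  rw [map_smul, smul_apply, contMultiplier_fourier_pointMass, pointMass_smul]

/-- A trigonometric polynomial extends to an entire function, so the identity theorem applies. -/
theorem sum_smul_fourier_eq_zero {S : Finset ℤ} {c : ℤ → ℂ} {a b : ℝ} (hab : a < b)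
    (h : ∀ x ∈ Set.Ioo a b, (∑ n ∈ S, c n • fourier (T := (1 : ℝ)) n) (x : UnitAddCircle) = 0) :
    ∑ n ∈ S, c n • fourier (T := (1 : ℝ)) n = 0 := by
  set G : ℂ → ℂ := fun w => ∑ n ∈ S, c n * Complex.exp (2 * Real.pi * Complex.I * n * w) with hG
  have hval : ∀ x : ℝ, (∑ n ∈ S, c n • fourier (T := (1 : ℝ)) n) (x : UnitAddCircle) = G x := by
    intro x
    rw [ContinuousMap.sum_apply]
    refine Finset.sum_congr rfl fun n _ => ?_
    rw [ContinuousMap.smul_apply, fourier_coe_apply, smul_eq_mul]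
    simp
  have hana : AnalyticOnNhd ℂ G Set.univ := by
    have hd : Differentiable ℂ G := by fun_prop
    exact fun w _ => hd.analyticAt w
  have htend : Tendsto (fun x : ℝ => (x : ℂ)) (𝓝[≠] ((a + b) / 2)) (𝓝[≠] (((a + b) / 2 : ℝ) : ℂ)) :=
    tendsto_nhdsWithin_of_tendsto_nhds_of_eventually_within _
      (Complex.continuous_ofReal.continuousAt.tendsto.mono_left nhdsWithin_le_nhds)
      (eventually_mem_nhdsWithin.mono fun x hx => by exact Complex.ofReal_injective.ne hx)
  have hfreq : ∃ᶠ w in 𝓝[≠] (((a + b) / 2 : ℝ) : ℂ), G w = 0 := by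
    refine htend.frequently (Eventually.frequently ?_)
    filter_upwards [nhdsWithin_le_nhds (Ioo_mem_nhds (by linarith : a < (a + b) / 2)
      (by linarith : (a + b) / 2 < b))] with x hx
    rw [← hval, h x hx]
  have h0 := hana.eqOn_zero_of_preconnected_of_frequently_eq_zero isPreconnected_univ
    (Set.mem_univ _) hfreq
  ext y
  induction y using QuotientAddGroup.induction_on with
  | H x => exact (hval x).trans (h0 (Set.mem_univ _))

/-- Finite support would make the Fourier series a trigonometric polynomial F with (f - z)F = 0,
forcing F = 0 on the interval. -/
theorem infinite_support_of_mem_eigenspaceOf {f : C(UnitAddCircle, ℂ)} {z : ℂ} {a b : ℝ}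
    (hab : a < b) (hf : ∀ x ∈ Set.Ioo a b, f (x : UnitAddCircle) ≠ z)
    {ψ : EllTwo} (hψ : ψ ∈ eigenspaceOf (contMultiplier f) z) (h0 : ψ ≠ 0) :
    {n : ℤ | ψ n ≠ 0}.Infinite := by
  intro hfin
  have hrep := eq_contMultiplier_of_finite_support (S := hfin.toFinset) (ψ := ψ)
    (fun n hn => by simpa using hn)
  set F : C(UnitAddCircle, ℂ) := ∑ n ∈ hfin.toFinset, ψ n • fourier n with hF
  rw [mem_eigenspaceOf] at hψ
  have h1 : f * F - z • F = 0 := by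
    refine eq_zero_of_contMultiplier_pointMass ?_
    rw [map_sub, map_mul, map_smul, sub_apply, mul_apply_eq_comp,
      smul_apply, ← hrep, hψ, sub_self]
  have h2 : F = 0 := sum_smul_fourier_eq_zero hab fun x hx => by
    have h3 := congrArg (fun g : C(UnitAddCircle, ℂ) => g (x : UnitAddCircle)) h1
    simp only [ContinuousMap.sub_apply, ContinuousMap.mul_apply, ContinuousMap.smul_apply,
      ContinuousMap.zero_apply, smul_eq_mul, ← sub_mul] at h3
    exact (mul_eq_zero.1 h3).resolve_left (sub_ne_zero.2 (hf x hx))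
  refine h0 ?_
  rw [hrep, h2, map_zero, zero_apply]

theorem exists_flatBand_modFourGraph :
    ∃ z : ℝ, ¬ FiniteDimensional ℂ (eigenspaceOf modFourGraph.adjacency z) ∧
      ∀ ψ ∈ eigenspaceOf modFourGraph.adjacency z, ψ ≠ 0 → {n : ℤ | ψ n ≠ 0}.Infinite := by
  have hpi := Real.pi_pos
  refine ⟨-(Real.pi ^ 2 / 8), ?_, ?_⟩
  · rw [← PeriodicGraph.contMultiplier_symbol]
    -- The negative part of the tent is a continuous function that is nonzero exactly on the open
    -- arc (1/4, 3/4), inside the plateau.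
    set p : C(UnitAddCircle, ℂ) :=
      ⟨fun y => ((max 0 (-(oddGraph.symbol y).re) : ℝ) : ℂ), by fun_prop⟩ with hp
    have hhalf : p ((1 / 2 : ℝ) : UnitAddCircle) ≠ 0 := by
      change ((max 0 (-(oddGraph.symbol ((1 / 2 : ℝ) : UnitAddCircle)).re) : ℝ) : ℂ) ≠ 0
      rw [symbol_oddGraph_left ⟨by norm_num, le_rfl⟩, Complex.ofReal_re, Complex.ofReal_ne_zero]
      refine (lt_max_of_lt_right ?_).ne'
      nlinarith [sq_pos_of_pos hpi]
    have hmul : modFourGraph.symbol * p = ((-(Real.pi ^ 2 / 8) : ℝ) : ℂ) • p := by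
      ext y
      rw [ContinuousMap.mul_apply, ContinuousMap.smul_apply, smul_eq_mul]
      obtain ⟨x, hx, rfl⟩ : ∃ x ∈ Set.Ico (0 : ℝ) 1, (x : UnitAddCircle) = y :=
        ⟨circleFrac y, circleFrac_mem y, coe_equivIco⟩
      have hp0 : 0 ≤ (oddGraph.symbol (x : UnitAddCircle)).re → p (x : UnitAddCircle) = 0 := by
        intro h
        change ((max 0 (-(oddGraph.symbol (x : UnitAddCircle)).re) : ℝ) : ℂ) = 0
        rw [max_eq_left (by linarith), Complex.ofReal_zero]
      rcases le_total x (1 / 4) with h1 | h1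
      · rw [hp0, mul_zero, mul_zero]
        rw [symbol_oddGraph_left ⟨hx.1, by linarith⟩, Complex.ofReal_re]
        nlinarith [sq_pos_of_pos hpi]
      rcases le_total x (3 / 4) with h2 | h2
      · rw [symbol_modFourGraph_middle ⟨h1, h2⟩]
      · rw [hp0, mul_zero, mul_zero]
        rw [symbol_oddGraph_right ⟨by linarith, hx.2.le⟩, Complex.ofReal_re]
        nlinarith [sq_pos_of_pos hpi]
    refine not_finiteDimensional_eigenspaceOf (ψ := contMultiplier p (pointMass 0)) ?_ fun h => ?_
    · rw [mem_eigenspaceOf, ← mul_apply_eq_comp, ← map_mul, hmul, map_smul,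
        smul_apply]
    · rw [eq_zero_of_contMultiplier_pointMass h] at hhalf
      exact hhalf rfl
  · rw [← PeriodicGraph.contMultiplier_symbol]
    refine fun ψ hψ h0 => infinite_support_of_mem_eigenspaceOf (a := 0) (b := 1 / 4) (by norm_num)
      (fun x hx => ?_) hψ h0
    rw [symbol_modFourGraph_left ⟨hx.1.le, hx.2.le⟩, Ne, Complex.ofReal_inj]
    have := hx.2
    intro h
    nlinarith [sq_pos_of_pos hpi]

end

theorem theorem1p1 :
    -- (1)
    (PurelyAbsolutelyContinuousSpectrum fullGraph.adjacency ∧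
      (∀ ψ : EllTwo, ψ ≠ 0 → HasFiniteDisplacement ψ →
        SpreadsBallistically fullGraph.adjacency ψ) ∧
      Disperses fullGraph.adjacency (1 / 2) ∧
      ¬ Disperses latticeGraph.adjacency (1 / 2)) ∧
    -- (2)
    (PurelyAbsolutelyContinuousSpectrum oddGraph.adjacency ∧
      (∀ ψ : EllTwo, ψ ≠ 0 → HasFiniteDisplacement ψ →
        SpreadsBallistically oddGraph.adjacency ψ) ∧
      (∀ α : ℝ, 0 < α → ¬ Disperses oddGraph.adjacency α) ∧
      (∀ (n : ℤ) (t : ℝ),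
        1 / Real.pi < supNorm (evolution oddGraph.adjacency t (pointMass n))) ∧
      -- the wave starts at `n`, and splits into two tents, located at `n ± πt/2` at time `t`
      (∀ n : ℤ, evolution oddGraph.adjacency 0 (pointMass n) = pointMass n) ∧
      (∀ (n : ℤ) (t : ℝ), 0 ≤ t →
        1 / Real.pi <
          ‖evolution oddGraph.adjacency t (pointMass n) (n + ⌊Real.pi * t / 2⌋)‖ ∧
        1 / Real.pi <
          ‖evolution oddGraph.adjacency t (pointMass n) (n - ⌊Real.pi * t / 2⌋)‖) ∧
      -- the peaks at the times `t = 2k/π`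
      (∀ n k : ℤ, 1 ≤ k →
        ‖evolution oddGraph.adjacency (2 * k / Real.pi) (pointMass n) (n + k)‖ = 1 / 2 ∧
        ‖evolution oddGraph.adjacency (2 * k / Real.pi) (pointMass n) (n - k)‖ = 1 / 2) ∧
      (∀ n k m : ℤ, 2 ≤ k → |m| ≠ k →
        ‖evolution oddGraph.adjacency (2 * k / Real.pi) (pointMass n) (n + m)‖ < 1 / 2) ∧
      -- polynomial decay away from the peaks
      (∀ (n m : ℤ) (t : ℝ), 0 ≤ t → |(m : ℝ)| ≠ Real.pi * t / 2 →
        ‖evolution oddGraph.adjacency t (pointMass n) (n + m)‖ ≤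
          2 / Real.pi * ((Real.pi * t / 2) / |(Real.pi * t / 2) ^ 2 - (m : ℝ) ^ 2|))) ∧
    -- (3)
    ((∃ z : ℝ, ¬ FiniteDimensional ℂ (eigenspaceOf modFourGraph.adjacency z) ∧
        ∀ ψ ∈ eigenspaceOf modFourGraph.adjacency z, ψ ≠ 0 → {n : ℤ | ψ n ≠ 0}.Infinite) ∧
      (∀ α : ℝ, 0 < α → ¬ Disperses modFourGraph.adjacency α) ∧
      (∀ t : ℝ, 3 / 10 ≤ ‖evolution modFourGraph.adjacency t (pointMass 0) 0‖)) := by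
  refine ⟨⟨spectral_and_ballistic_fullGraph.1, spectral_and_ballistic_fullGraph.2,
    disperses_fullGraph, not_disperses_latticeGraph⟩, ⟨spectral_and_ballistic_oddGraph.1,
    spectral_and_ballistic_oddGraph.2, fun α hα => not_disperses_oddGraph hα,
    one_div_pi_lt_supNorm_oddGraph, fun n => evolution_zero _ _, two_tents⟩,
    exists_flatBand_modFourGraph, fun α hα => not_disperses_modFourGraph hα,
    le_norm_evolution_modFourGraph⟩
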